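/- Let $n\ge 0$ and let $\overrightarrow{G}=([n],E)$ be a directed graph without loops and with at most one edge $(u,v)$ for every ordered pair $u\ne v$ (both $(u,v)$ and $(v,u)$ may be edges). Let $G$ be its underlying simple undirected graph: $u\ne v$ are adjacent iff $(u,v)\in E$ or $(v,u)\in E$. The chromatic quasisymmetric function of $\overrightarrow{G}$ is $$X_{\overrightarrow{G}}(\mathbf{x},t)=\sum_{\kappa}t^{\mathrm{asc}(\kappa)}\prod_{v\in[n]}x_{\kappa(v)},$$ where $\kappa:[n]\to\{1,2,\dots\}$ runs over the proper colorings of $G$ and $\mathrm{asc}(\kappa)=|\{(u,v)\in E:\kappa(u)<\kappa(v)\}|$. Let $\Lambda_{\mathbb{Q}[t]}$ be the ring of symmetric functions in $x_1,x_2,\dots$ with coefficients in $\mathbb{Q}[t]$, and let $\omega$ be the involution on it, i.e. the $\mathbb{Q}[t]$-algebra endomorphism that sends the complete homogeneous symmetric function $h_k$ to the elementary symmetric function $e_k$ for every $k$. For a permutation $\sigma=\sigma_1\sigma_2\cdots\sigma_n\in\mathfrak{S}_n$, let $\mathrm{inv}_{\overrightarrow{G}}(\sigma)$ be the number of edges $(u,v)\in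 E$ such that $v$ precedes $u$ in $\sigma$. The rank of a letter $x$ in $\sigma$ is the length of the longest subword $\sigma_{i_1}\cdots\sigma_{i_k}$, $i_1<\cdots<i_k$, with $\sigma_{i_k}=x$ and $\sigma_{i_j}$ adjacent to $\sigma_{i_{j+1}}$ in $G$ for $1\le j<k$. The permutation $\sigma$ has a $G$-descent at $i$, $1\le i<n$, if $\mathrm{rank}(\sigma_i)>\mathrm{rank}(\sigma_{i+1})$, or if these ranks are equal and $\sigma_i>\sigma_{i+1}$. A letter $w_j$, $j>1$, of a word $w=w_1\cdots w_k$ is $G$-isolated if no $w_i$ with $i<j$ is adjacent to $w_j$ in $G$. For a partition $\lambda=(\lambda_1\ge\dots\ge\lambda_l)$ of $n$, let $N_\lambda(G)$ be the set of all $\sigma\in\mathfrak{S}_n$ such that, when $\sigma$ is cut into contiguous segments $\alpha_1,\dots,\alpha_l$ of lengths $\lambda_1,\dots,\lambda_l$, no $\alpha_i$ has a $G$-isolated letter and no $\alpha_i$ contains a $G$-descent of $\sigma$ (that is, $\sigma$ has no $G$-descent at a position $j$ for which $j$ and $j+1$ lie in the same segment). Let $p_\lambda=\prod_i p_{\lambda_i}$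 with $p_k=\sum_i x_i^k$, and $z_\lambda=\prod_i m_i(\lambda)!\,i^{m_i(\lambda)}$, where $m_i(\lambda)$ is the multiplicity of $i$ in $\lambda$. **Theorem.** If $X_{\overrightarrow{G}}(\mathbf{x},t)$ is symmetric, i.e. $X_{\overrightarrow{G}}(\mathbf{x},t)\in\Lambda_{\mathbb{Q}[t]}$, then $$\omega X_{\overrightarrow{G}}(\mathbf{x},t)=\sum_{\lambda\vdash n}z_\lambda^{-1}\,p_\lambda(\mathbf{x})\sum_{\sigma\in N_\lambda(G)}t^{\mathrm{inv}_{\overrightarrow{G}}(\sigma)}.$$ In particular $\omega X_{\overrightarrow{G}}(\mathbf{x},t)$ is $p$-positive: its expansion in the $p_\lambda$, $\lambda\vdash n$, has coefficients in $\mathbb{Q}[t]$ all of whose coefficients are nonnegative. -/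

import Mathlib

noncomputable section

namespace ChromQSym

open MvPowerSeries Finsupp

variable (R : Type*) [CommRing R]

/-- The ring `Λ_R` of symmetric functions over `R`: the formal power series of bounded degree in
countably many variables that are fixed by every permutation of the variables. The variable
`x_i`, `i = 1, 2, …`, is the one with index `i - 1`. -/
def SymFunc : Subalgebra R (MvPowerSeries ℕ R) where
  carrier := {f | (∃ d : ℕ, ∀ m : ℕ →₀ ℕ, d < m.degree → coeff m f = 0) ∧
    ∀ π : Equiv.Perm ℕ, rename π f = f}
  mul_mem' := by
    classical
    rintro f g ⟨⟨d, hd⟩, hf⟩ ⟨⟨e, he⟩, hg⟩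
    refine ⟨⟨d + e, fun m hm => ?_⟩, fun π => by rw [map_mul, hf, hg]⟩
    rw [coeff_mul]
    refine Finset.sum_eq_zero fun p hp => ?_
    rw [Finset.HasAntidiagonal.mem_antidiagonal] at hp
    have hdeg : p.1.degree + p.2.degree = m.degree := by rw [← hp, map_add]
    by_cases h : d < p.1.degree
    · rw [hd _ h, zero_mul]
    · rw [he _ (by omega), mul_zero]
  add_mem' := by
    rintro f g ⟨⟨d, hd⟩, hf⟩ ⟨⟨e, he⟩, hg⟩
    refine ⟨⟨max d e, fun m hm => ?_⟩, fun π => by rw [map_add, hf, hg]⟩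
    rw [map_add, hd m (by omega), he m (by omega), add_zero]
  algebraMap_mem' r := by
    classical
    refine ⟨⟨0, fun m hm => ?_⟩, fun π => AlgHom.commutes _ r⟩
    rw [MvPowerSeries.algebraMap_apply, coeff_C, if_neg]
    rintro rfl
    simp at hm

variable {R}

theorem coeff_mapDomain_perm_rename (π : Equiv.Perm ℕ) (f : MvPowerSeries ℕ R) (m : ℕ →₀ ℕ) :
    coeff (mapDomain π m) (rename π f) = coeff m f := by
  have := coeff_embDomain_rename π.toEmbedding f m
  rwa [embDomain_eq_mapDomain] at this

theorem rename_perm_eq_of_coeff {f : MvPowerSeries ℕ R} (π : Equiv.Perm ℕ)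
    (h : ∀ m : ℕ →₀ ℕ, coeff (mapDomain π m) f = coeff m f) : rename π f = f := by
  ext m
  obtain ⟨m', rfl⟩ : ∃ m', mapDomain π m' = m :=
    ⟨mapDomain π.symm m, by rw [← mapDomain_comp]; simp⟩
  rw [coeff_mapDomain_perm_rename, h]

variable (R) in
open Classical in
/-- The elementary symmetric function `e_k`: the sum of all square-free monomials of degree `k`. -/
def esymm (k : ℕ) : SymFunc R :=
  ⟨fun m => if m.degree = k ∧ ∀ i, m i ≤ 1 then 1 else 0, by
    refine ⟨⟨k, fun m hm => if_neg fun h => hm.ne' h.1⟩,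
      fun π => rename_perm_eq_of_coeff π fun m => ?_⟩
    refine if_congr ?_ rfl rfl
    rw [Finsupp.degree_mapDomain]
    refine and_congr_right fun _ => ⟨fun h i => ?_, fun h i => ?_⟩
    · simpa [mapDomain_equiv_apply] using h (π i)
    · simpa [mapDomain_equiv_apply] using h (π.symm i)⟩

variable (R) in
open Classical in
/-- The complete homogeneous symmetric function `h_k`: the sum of all monomials of degree `k`. -/
def hsymm (k : ℕ) : SymFunc R :=
  ⟨fun m => if m.degree = k then 1 else 0, by
    refine ⟨⟨k, fun m hm => if_neg hm.ne'⟩,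
      fun π => rename_perm_eq_of_coeff π fun m => ?_⟩
    refine if_congr ?_ rfl rfl
    rw [Finsupp.degree_mapDomain]⟩

variable (R) in
open Classical in
/-- The power sum symmetric function `p_k`, `k ≥ 1`: the sum of all `x_i ^ k`.
(For `k = 0`, which never occurs, this gives `1`.) -/
def psum (k : ℕ) : SymFunc R :=
  ⟨fun m => if ∃ i, m = single i k then 1 else 0, by
    refine ⟨⟨k, fun m hm => if_neg ?_⟩,
      fun π => rename_perm_eq_of_coeff π fun m => if_congr ?_ rfl rfl⟩
    · rintro ⟨i, rfl⟩
      simp at hm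
    · refine ⟨fun ⟨i, hi⟩ => ⟨π.symm i, mapDomain_injective π.injective ?_⟩, fun ⟨i, hi⟩ => ⟨π i, ?_⟩⟩
      · rw [hi, mapDomain_single, π.apply_symm_apply]
      · rw [hi, mapDomain_single]⟩

open Classical in
theorem coeff_esymm (k : ℕ) (m : ℕ →₀ ℕ) :
    coeff m (esymm R k : MvPowerSeries ℕ R) = if m.degree = k ∧ ∀ i, m i ≤ 1 then 1 else 0 := rfl

open Classical in
theorem coeff_hsymm (k : ℕ) (m : ℕ →₀ ℕ) :
    coeff m (hsymm R k : MvPowerSeries ℕ R) = if m.degree = k then 1 else 0 := rfl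

/-- Setting all but the first `N` variables to zero. -/
def restr (N : ℕ) : SymFunc R →ₐ[R] MvPowerSeries (Fin N) R :=
  (killCompl Fin.valEmbedding).comp (SymFunc R).val

theorem restr_esymm (N k : ℕ) : restr N (esymm R k) = (MvPolynomial.esymm (Fin N) R k : MvPowerSeries (Fin N) R) := by
  classical
  ext m
  rw [MvPolynomial.coeff_coe, MvPolynomial.esymm_eq_sum_monomial, MvPolynomial.coeff_sum]
  simp only [restr, AlgHom.comp_apply, Subalgebra.val_apply, coeff_killCompl, coeff_esymm, MvPolynomial.coeff_monomial]
  rw [embDomain_eq_mapDomain, Finsupp.degree_mapDomain]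
  have key : ∀ t : Finset (Fin N), (∑ i ∈ t, single i 1) = m ↔ (t = m.support ∧ ∀ i, m i ≤ 1) := by
    intro t
    have h1 : ∀ i, (∑ j ∈ t, single j 1 : Fin N →₀ ℕ) i = if i ∈ t then 1 else 0 := by
      intro i; simp [Finsupp.finsetSum_apply, single_apply]
    constructor
    · rintro rfl
      refine ⟨by ext i; simp [h1], fun i => by rw [h1]; split_ifs <;> simp⟩
    · rintro ⟨rfl, h⟩
      ext i
      rw [h1]
      have := h i
      by_cases h0 : m i = 0
      · simp [h0]
      · rw [if_pos (by simpa using h0)]; omega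
  simp only [key]
  have hm : (∀ i, (mapDomain (Fin.valEmbedding : Fin N ↪ ℕ) m) i ≤ 1) ↔ ∀ i, m i ≤ 1 := by
    constructor
    · intro h i
      have := h (Fin.valEmbedding i)
      rwa [mapDomain_apply Fin.valEmbedding.injective] at this
    · intro h i
      by_cases hi : i ∈ Set.range (Fin.valEmbedding : Fin N ↪ ℕ)
      · obtain ⟨j, rfl⟩ := hi
        rw [mapDomain_apply Fin.valEmbedding.injective]; exact h j
      · rw [mapDomain_of_notMem_range _ _ hi]; simp
  rw [hm]
  by_cases h : ∀ i, m i ≤ 1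
  · have hd : m.degree = m.support.card := by
      rw [Finsupp.degree_apply, Finset.card_eq_sum_ones]
      refine Finset.sum_congr rfl fun i hi => ?_
      have := h i
      have := mem_support_iff.1 hi
      omega
    simp [h, hd, Finset.sum_ite_eq', Finset.mem_powersetCard]
  · simp [h]

variable (R) in
/-- Evaluation of polynomials at `e_1, e_2, …`. -/
def ofEsymm : MvPolynomial ℕ R →ₐ[R] SymFunc R := MvPolynomial.aeval fun i => esymm R (i + 1)

theorem restr_ofEsymm_rename (N : ℕ) (Q : MvPolynomial (Fin N) R) :
    restr N (ofEsymm R (MvPolynomial.rename Fin.val Q)) =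
      ((MvPolynomial.esymmAlgHom (Fin N) R N Q : MvPolynomial (Fin N) R) : MvPowerSeries (Fin N) R) := by
  have : ((restr N).comp (ofEsymm R)).comp (MvPolynomial.rename Fin.val) =
    ((MvPolynomial.coeToMvPowerSeries.algHom R).comp (MvPolynomial.symmetricSubalgebra (Fin N) R).val).comp (MvPolynomial.esymmAlgHom (Fin N) R N) := by
    refine MvPolynomial.algHom_ext fun i => ?_
    simp [ofEsymm, restr_esymm, MvPolynomial.esymmAlgHom]
  simpa using DFunLike.congr_fun this Q

theorem ofEsymm_injective : Function.Injective (ofEsymm R) := by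
  rw [injective_iff_map_eq_zero]
  intro P hP
  obtain ⟨s, q, rfl⟩ := MvPolynomial.exists_finset_rename P
  obtain ⟨N, hN⟩ : ∃ N, ∀ i ∈ s, i < N := ⟨s.sup id + 1, fun i hi => Nat.lt_succ_of_le (Finset.le_sup (f := id) hi)⟩
  have h1 : MvPolynomial.rename (Subtype.val : {x // x ∈ s} → ℕ) q =
      MvPolynomial.rename Fin.val (MvPolynomial.rename (fun i : {x // x ∈ s} => (⟨i, hN i i.2⟩ : Fin N)) q) := by
    rw [MvPolynomial.rename_rename]; rfl
  rw [h1] at hP ⊢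
  have h2 := restr_ofEsymm_rename N (MvPolynomial.rename (fun i : {x // x ∈ s} => (⟨i, hN i i.2⟩ : Fin N)) q)
  rw [hP, map_zero] at h2
  have h3 := MvPolynomial.esymmAlgHom_injective R (σ := Fin N) (n := N) (by simp)
  have h4 : MvPolynomial.esymmAlgHom (Fin N) R N (MvPolynomial.rename (fun i : {x // x ∈ s} => (⟨i, hN i i.2⟩ : Fin N)) q) = 0 := by
    apply Subtype.ext
    apply MvPolynomial.coe_injective
    simpa using h2.symm
  rw [(map_eq_zero_iff _ h3).1 h4, map_zero]

theorem ofEsymm_trunc (d : ℕ) (P : MvPolynomial ℕ R) : ∃ P' : MvPolynomial ℕ R, ∀ m : ℕ →₀ ℕ,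
    coeff m (ofEsymm R P' : MvPowerSeries ℕ R) =
      if m.degree ≤ d then coeff m (ofEsymm R P : MvPowerSeries ℕ R) else 0 := by
  induction P using MvPolynomial.induction_on' with
  | monomial s r =>
    have hom : ∃ w, ∀ m : ℕ →₀ ℕ, m.degree ≠ w →
        coeff m (ofEsymm R (MvPolynomial.monomial s r) : MvPowerSeries ℕ R) = 0 := by
      induction s using Finsupp.induction_linear generalizing r with
      | zero =>
        refine ⟨0, fun m hm => ?_⟩
        classical
        have : ofEsymm R (MvPolynomial.monomial 0 r) = algebraMap R _ r := by
          rw [← MvPolynomial.C_apply, ← MvPolynomial.algebraMap_eq, AlgHom.commutes]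
        rw [this, Subalgebra.coe_algebraMap, MvPowerSeries.algebraMap_apply, coeff_C, if_neg]
        rintro rfl; simp at hm
      | add f g hf hg =>
        obtain ⟨a, ha⟩ := hf r
        obtain ⟨b, hb⟩ := hg 1
        refine ⟨a + b, fun m hm => ?_⟩
        classical
        rw [← mul_one r, ← MvPolynomial.monomial_mul, map_mul, Subalgebra.coe_mul, coeff_mul]
        refine Finset.sum_eq_zero fun p hp => ?_
        rw [Finset.HasAntidiagonal.mem_antidiagonal] at hp
        have hdeg : p.1.degree + p.2.degree = m.degree := by rw [← hp, map_add]
        by_cases h : p.1.degree = a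
        · rw [hb _ (by omega), mul_zero]
        · rw [ha _ h, zero_mul]
      | single i k =>
        induction k generalizing r with
        | zero =>
          refine ⟨0, fun m hm => ?_⟩
          classical
          have : ofEsymm R (MvPolynomial.monomial (single i 0) r) = algebraMap R _ r := by
            rw [single_zero, ← MvPolynomial.C_apply, ← MvPolynomial.algebraMap_eq, AlgHom.commutes]
          rw [this, Subalgebra.coe_algebraMap, MvPowerSeries.algebraMap_apply, coeff_C, if_neg]
          rintro rfl; simp at hm
        | succ k ih =>
          obtain ⟨a, ha⟩ := ih r
          refine ⟨a + (i + 1), fun m hm => ?_⟩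
          classical
          rw [single_add, ← mul_one r, ← MvPolynomial.monomial_mul, map_mul, Subalgebra.coe_mul, coeff_mul]
          refine Finset.sum_eq_zero fun p hp => ?_
          rw [Finset.HasAntidiagonal.mem_antidiagonal] at hp
          have hdeg : p.1.degree + p.2.degree = m.degree := by rw [← hp, map_add]
          by_cases h : p.1.degree = a
          · have : ofEsymm R (MvPolynomial.monomial (single i 1) 1) = esymm R (i + 1) := by
              rw [← MvPolynomial.X, ofEsymm, MvPolynomial.aeval_X]
            rw [this, coeff_esymm, if_neg (by rintro ⟨h', -⟩; omega), mul_zero]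
          · rw [ha _ h, zero_mul]
    obtain ⟨w, hw⟩ := hom
    by_cases h : w ≤ d
    · refine ⟨MvPolynomial.monomial s r, fun m => ?_⟩
      split_ifs with hm
      · rfl
      · exact hw m (by omega)
    · refine ⟨0, fun m => ?_⟩
      rw [map_zero, ZeroMemClass.coe_zero, map_zero]
      split_ifs with hm
      · exact (hw m (by omega)).symm
      · rfl
  | add p q hp hq =>
    obtain ⟨p', hp'⟩ := hp
    obtain ⟨q', hq'⟩ := hq
    refine ⟨p' + q', fun m => ?_⟩
    rw [map_add, map_add, Subalgebra.coe_add, Subalgebra.coe_add, map_add, map_add, hp', hq']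
    split_ifs <;> simp

theorem exists_perm_lt_card (s : Finset ℕ) : ∃ π : Equiv.Perm ℕ, ∀ i ∈ s, π i < s.card := by
  classical
  induction s using Finset.induction_on with
  | empty => exact ⟨1, by simp⟩
  | insert a s ha ih =>
    obtain ⟨π, hπ⟩ := ih
    refine ⟨π.trans (Equiv.swap (π a) s.card), fun i hi => ?_⟩
    rw [Finset.card_insert_of_notMem ha, Equiv.trans_apply]
    rcases Finset.mem_insert.1 hi with rfl | hi
    · rw [Equiv.swap_apply_left]; omega
    · have h1 : π i ≠ π a := fun h => ha (π.injective h ▸ hi)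
      have h2 := hπ i hi
      rw [Equiv.swap_apply_of_ne_of_ne h1 h2.ne]; omega

theorem eq_of_restr_eq {f g : SymFunc R} {d : ℕ}
    (hf : ∀ m : ℕ →₀ ℕ, d < m.degree → coeff m (f : MvPowerSeries ℕ R) = 0)
    (hg : ∀ m : ℕ →₀ ℕ, d < m.degree → coeff m (g : MvPowerSeries ℕ R) = 0)
    (h : ∀ m : Fin d →₀ ℕ, m.degree ≤ d → coeff m (restr d f) = coeff m (restr d g)) : f = g := by
  apply Subtype.ext
  ext m
  by_cases hm : d < m.degree
  · rw [hf m hm, hg m hm]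
  have hc : m.support.card ≤ m.degree := by
    rw [Finsupp.degree_apply, Finset.card_eq_sum_ones]
    refine Finset.sum_le_sum fun i hi => ?_
    have := mem_support_iff.1 hi
    omega
  obtain ⟨π, hπ⟩ := exists_perm_lt_card m.support
  obtain ⟨m', hm'⟩ : mapDomain π m ∈ Set.range (embDomain (Fin.valEmbedding : Fin d ↪ ℕ)) := by
    rw [mem_range_embDomain_iff]
    intro i hi
    obtain ⟨j, hj, rfl⟩ := Finset.mem_image.1 (mapDomain_support hi)
    have := hπ j hj
    exact ⟨⟨π j, by omega⟩, rfl⟩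
  have key : ∀ F : SymFunc R, coeff m (F : MvPowerSeries ℕ R) = coeff m' (restr d F) := by
    intro F
    rw [restr, AlgHom.comp_apply, Subalgebra.val_apply, coeff_killCompl, hm',
      ← coeff_mapDomain_perm_rename π, F.2.2 π]
  rw [key, key]
  apply h
  have h1 : (mapDomain π m).degree = m.degree := Finsupp.degree_mapDomain _ _
  have h2 : (embDomain (Fin.valEmbedding : Fin d ↪ ℕ) m').degree = m'.degree := by
    rw [embDomain_eq_mapDomain, Finsupp.degree_mapDomain]
  rw [← h2, hm', h1]
  omega

theorem ofEsymm_surjective : Function.Surjective (ofEsymm R) := by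
  classical
  intro f
  obtain ⟨d, hd⟩ := f.2.1
  have hfin : {m : Fin d →₀ ℕ | m.degree ≤ d}.Finite := Finsupp.finite_of_degree_le d
  let g : MvPolynomial (Fin d) R :=
    ∑ m ∈ hfin.toFinset, MvPolynomial.monomial m (coeff m (restr d f))
  have hg : ∀ m, MvPolynomial.coeff m g = if m.degree ≤ d then coeff m (restr d f) else 0 := by
    intro m
    simp only [g, MvPolynomial.coeff_sum, MvPolynomial.coeff_monomial]
    rw [Finset.sum_ite_eq']
    simp
  have hsymm : g.IsSymmetric := by
    intro e
    ext m
    obtain ⟨m, rfl⟩ : ∃ m', mapDomain e m' = m :=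
      ⟨mapDomain e.symm m, by rw [← mapDomain_comp]; simp⟩
    rw [MvPolynomial.coeff_rename_mapDomain _ e.injective, hg, hg, Finsupp.degree_mapDomain]
    congr 1
    obtain ⟨π, hπ⟩ : ∃ π : Equiv.Perm ℕ, ∀ i : Fin d, π i = e i :=
      ⟨e.extendDomain Fin.equivSubtype, fun i => by
        have := e.extendDomain_apply_image Fin.equivSubtype i
        simpa using this⟩
    rw [restr, AlgHom.comp_apply, Subalgebra.val_apply, coeff_killCompl, coeff_killCompl,
      ← coeff_mapDomain_perm_rename π, f.2.2 π, embDomain_eq_mapDomain, embDomain_eq_mapDomain,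
      ← mapDomain_comp, ← mapDomain_comp]
    congr 2
    exact congrArg (fun F : Fin d → ℕ => mapDomain F m) (funext fun i => hπ i)
  obtain ⟨Q, hQ⟩ := MvPolynomial.esymmAlgHom_fin_surjective R (le_refl d) ⟨g, hsymm⟩
  obtain ⟨P, hP⟩ := ofEsymm_trunc d (MvPolynomial.rename Fin.val Q)
  refine ⟨P, eq_of_restr_eq (d := d) (fun m hm => ?_) hd fun m hm => ?_⟩
  · rw [hP, if_neg (by omega)]
  · have h1 : coeff m (restr d (ofEsymm R P)) =
        coeff m (restr d (ofEsymm R (MvPolynomial.rename Fin.val Q))) := by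
      rw [restr, AlgHom.comp_apply, AlgHom.comp_apply, Subalgebra.val_apply, Subalgebra.val_apply,
        coeff_killCompl, coeff_killCompl, hP, if_pos]
      rwa [embDomain_eq_mapDomain, Finsupp.degree_mapDomain]
    rw [h1, restr_ofEsymm_rename, hQ, MvPolynomial.coeff_coe, hg, if_pos hm]

theorem esymm_zero : esymm R 0 = 1 := by
  classical
  apply Subtype.ext
  ext m
  rw [coeff_esymm, Subalgebra.coe_one, coeff_one]
  refine if_congr ?_ rfl rfl
  rw [Finsupp.degree_eq_zero_iff]
  constructor
  · exact fun h => h.1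
  · rintro rfl; simp

theorem hsymm_zero : hsymm R 0 = 1 := by
  classical
  apply Subtype.ext
  ext m
  rw [coeff_hsymm, Subalgebra.coe_one, coeff_one]
  exact if_congr (Finsupp.degree_eq_zero_iff _) rfl rfl

theorem sum_esymm_mul_hsymm {k : ℕ} (hk : k ≠ 0) :
    ∑ p ∈ Finset.HasAntidiagonal.antidiagonal k, (-1) ^ p.1 * (esymm R p.1 * hsymm R p.2) = 0 := by
  classical
  apply Subtype.ext
  ext m
  have h1 : ∀ p : ℕ × ℕ, coeff m (((-1) ^ p.1 * (esymm R p.1 * hsymm R p.2) : SymFunc R) :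
      MvPowerSeries ℕ R) = ∑ q ∈ Finset.HasAntidiagonal.antidiagonal m,
        if (q.1.degree, q.2.degree) = p then (if ∀ i, q.1 i ≤ 1 then (-1) ^ q.1.degree else 0)
          else 0 := by
    intro p
    have : (((-1) ^ p.1 * (esymm R p.1 * hsymm R p.2) : SymFunc R) : MvPowerSeries ℕ R) =
        C ((-1) ^ p.1) * ((esymm R p.1 : MvPowerSeries ℕ R) * (hsymm R p.2 : MvPowerSeries ℕ R)) := by
      simp
    rw [this, coeff_C_mul, coeff_mul, Finset.mul_sum]
    refine Finset.sum_congr rfl fun q _ => ?_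
    rw [coeff_esymm, coeff_hsymm]
    obtain ⟨p1, p2⟩ := p
    simp only [Prod.mk.injEq]
    by_cases ha : q.1.degree = p1 <;> by_cases hb : q.2.degree = p2 <;> simp [ha, hb]
  rw [AddSubmonoidClass.coe_finsetSum, map_sum, Finset.sum_congr rfl fun p _ => h1 p,
    Finset.sum_comm, ZeroMemClass.coe_zero, map_zero]
  simp only [Finset.sum_ite_eq, Finset.HasAntidiagonal.mem_antidiagonal]
  by_cases hm : m.degree = k
  · have hne : m.support.Nonempty := by
      rw [support_nonempty_iff]; rintro rfl; simp at hm; omega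
    have h2 := Finset.sum_powerset_neg_one_pow_card_of_nonempty hne
    have h3 : (∑ t ∈ m.support.powerset, (-1 : R) ^ t.card) = 0 := by
      exact_mod_cast congrArg (Int.cast : ℤ → R) h2
    have h4 : ∀ q ∈ Finset.HasAntidiagonal.antidiagonal m, q.1.degree + q.2.degree = k := by
      intro q hq
      rw [Finset.HasAntidiagonal.mem_antidiagonal] at hq
      rw [← hm, ← hq, map_add]
    rw [Finset.sum_congr rfl fun q hq => if_pos (h4 q hq), ← Finset.sum_filter, ← h3]
    have hind : ∀ (t : Finset ℕ) i, (∑ j ∈ t, single j 1 : ℕ →₀ ℕ) i = if i ∈ t then 1 else 0 := by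
      intro t i; simp [Finsupp.finsetSum_apply, single_apply]
    refine Finset.sum_bij' (fun q _ => q.1.support)
      (fun t _ => (∑ j ∈ t, single j 1, m - ∑ j ∈ t, single j 1)) ?_ ?_ ?_ ?_ ?_
    · intro q hq
      simp only [Finset.mem_filter, Finset.HasAntidiagonal.mem_antidiagonal] at hq
      rw [Finset.mem_powerset, ← hq.1]
      exact support_mono (le_self_add)
    · intro t ht
      rw [Finset.mem_powerset] at ht
      simp only [Finset.mem_filter, Finset.HasAntidiagonal.mem_antidiagonal]
      refine ⟨add_tsub_cancel_of_le fun i => ?_, fun i => ?_⟩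
      · rw [hind]; split_ifs with h
        · exact Nat.one_le_iff_ne_zero.2 (mem_support_iff.1 (ht h))
        · simp
      · rw [hind]; split_ifs <;> simp
    · intro q hq
      simp only [Finset.mem_filter, Finset.HasAntidiagonal.mem_antidiagonal] at hq
      have h5 : ∑ j ∈ q.1.support, single j 1 = q.1 := by
        ext i
        rw [hind]
        have := hq.2 i
        by_cases h0 : q.1 i = 0
        · simp [h0]
        · rw [if_pos (by simpa using h0)]; omega
      ext1
      · exact h5
      · simp only [h5]
        rw [← hq.1, add_tsub_cancel_left]
    · intro t ht
      ext i
      simp [hind]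
    · intro q hq
      simp only [Finset.mem_filter] at hq
      congr 1
      rw [Finsupp.degree_apply, Finset.card_eq_sum_ones]
      refine Finset.sum_congr rfl fun i hi => ?_
      have := hq.2 i
      have := mem_support_iff.1 hi
      omega
  · refine Finset.sum_eq_zero fun q hq => if_neg fun h => hm ?_
    rw [Finset.HasAntidiagonal.mem_antidiagonal] at hq
    rw [← hq, map_add, h]

theorem neg_one_pow_mul_self {A : Type*} [CommRing A] (k : ℕ) :
    (-1 : A) ^ k * (-1) ^ k = 1 := by
  rw [← pow_add, ← two_mul, pow_mul, neg_one_sq, one_pow]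

variable (R) in
/-- There is exactly one algebra endomorphism of `Λ_R` that sends each `h_k` to `e_k`. -/
theorem existsUnique_omega : ∃! w : SymFunc R →ₐ[R] SymFunc R, ∀ k, w (hsymm R k) = esymm R k := by
  let e : MvPolynomial ℕ R ≃ₐ[R] SymFunc R :=
    AlgEquiv.ofBijective (ofEsymm R) ⟨ofEsymm_injective, ofEsymm_surjective⟩
  let w : SymFunc R →ₐ[R] SymFunc R :=
    (MvPolynomial.aeval fun i => hsymm R (i + 1)).comp (e.symm : SymFunc R →ₐ[R] MvPolynomial ℕ R)
  have hwe : ∀ k, w (esymm R k) = hsymm R k := by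
    rintro (_ | k)
    · rw [esymm_zero, hsymm_zero, map_one]
    · have h : e (MvPolynomial.X k) = esymm R (k + 1) := by
        simp [e, ofEsymm]
      simp [w, ← h]
  have hwh : ∀ k, w (hsymm R k) = esymm R k := by
    intro k
    induction k using Nat.strong_induction_on with
    | _ k ih =>
      rcases Nat.eq_zero_or_pos k with rfl | hk
      · rw [esymm_zero, hsymm_zero, map_one]
      obtain ⟨k, rfl⟩ : ∃ j, k = j + 1 := ⟨k - 1, by omega⟩
      have h1 := congrArg w (sum_esymm_mul_hsymm (R := R) hk.ne')
      simp only [map_sum, map_mul, map_pow, map_neg, map_one, hwe, map_zero] at h1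
      have h2 : ∑ p ∈ Finset.HasAntidiagonal.antidiagonal (k + 1),
          (-1) ^ p.1 * (hsymm R p.1 * esymm R p.2) = 0 := by
        have h3 := sum_esymm_mul_hsymm (R := R) hk.ne'
        rw [← Finset.Nat.sum_antidiagonal_swap] at h3
        have h4 := congrArg (fun x => (-1) ^ (k + 1) * x) h3
        simp only [mul_zero, Finset.mul_sum] at h4
        rw [← h4]
        refine Finset.sum_congr rfl fun p hp => ?_
        rw [Finset.HasAntidiagonal.mem_antidiagonal] at hp
        rw [← hp, pow_add]
        have : ((-1 : SymFunc R) ^ p.2) * (-1) ^ p.2 = 1 :=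
          neg_one_pow_mul_self p.2
        simp only [Prod.fst_swap, Prod.snd_swap]
        linear_combination (-(-1) ^ p.1 * (hsymm R p.1 * esymm R p.2)) * this
      rw [Finset.Nat.antidiagonal_succ, Finset.sum_cons, Finset.sum_map] at h1 h2
      have h5 : ∀ p ∈ Finset.HasAntidiagonal.antidiagonal k,
          w (hsymm R p.2) = esymm R p.2 := by
        intro p hp
        rw [Finset.HasAntidiagonal.mem_antidiagonal] at hp
        exact ih _ (by omega)
      rw [Finset.sum_congr rfl fun p hp => by
        rw [show ((Function.Embedding.prodMap ⟨Nat.succ, Nat.succ_injective⟩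
          (Function.Embedding.refl ℕ)) p).2 = p.2 from rfl, h5 p hp]] at h1
      have h6 := h1.trans h2.symm
      have h7 := add_right_cancel h6
      simpa [hsymm_zero] using h7
  have hww : ∀ f, w (w f) = f := by
    intro f
    obtain ⟨P, rfl⟩ := ofEsymm_surjective f
    have : (w.comp w).comp (ofEsymm R) = ofEsymm R :=
      MvPolynomial.algHom_ext fun i => by simp [ofEsymm, hwe, hwh]
    exact DFunLike.congr_fun this P
  refine ⟨w, hwh, fun w' hw' => ?_⟩
  have hid : ∀ f, w' (w f) = f := by
    intro f
    obtain ⟨P, rfl⟩ := ofEsymm_surjective f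
    have : (w'.comp w).comp (ofEsymm R) = ofEsymm R :=
      MvPolynomial.algHom_ext fun i => by simp [ofEsymm, hwe, hw']
    exact DFunLike.congr_fun this P
  refine AlgHom.ext fun f => ?_
  calc w' f = w' (w (w f)) := by rw [hww]
    _ = w f := hid _

variable (R) in
/-- The involution `ω` on `Λ_R`: the algebra endomorphism that sends each `h_k` to `e_k`. -/
def omegaInvolution : SymFunc R →ₐ[R] SymFunc R := (existsUnique_omega R).choose

theorem omegaInvolution_hsymm (k : ℕ) : omegaInvolution R (hsymm R k) = esymm R k :=
  (existsUnique_omega R).choose_spec.1 k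

variable (R) in
/-- `p_μ`, the product of the `p_{μ_i}` over the parts of `μ`. -/
def psumPart {n : ℕ} (μ : n.Partition) : SymFunc R := (μ.parts.map (psum R)).prod

/-- `z_μ = ∏_i m_i(μ)! i ^ {m_i(μ)}`, where `m_i(μ)` is the multiplicity of `i` in `μ`. -/
def zPart {n : ℕ} (μ : n.Partition) : ℕ :=
  ∏ i ∈ μ.parts.toFinset, (μ.parts.count i).factorial * i ^ μ.parts.count i

/-- A homogeneous symmetric function of degree `n` with coefficients in `ℚ[t]` is `p`-positive if its expansion
in the `p_μ`, `μ ⊢ n`, has polynomials in `t` with nonnegative coefficients as coefficients, i.e. if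
the coefficient of each power of `t` is a `p`-positive symmetric function over `ℚ`. -/
def IsPPositive (n : ℕ) (f : SymFunc (Polynomial ℚ)) : Prop :=
  ∃ c : n.Partition → Polynomial ℚ, (∀ μ j, 0 ≤ (c μ).coeff j) ∧
    f = ∑ μ : n.Partition, c μ • psumPart (Polynomial ℚ) μ

section Digraph

variable {V : Type*} [Fintype V]

/-- A proper colouring of a digraph is a proper colouring of its underlying undirected graph. -/
def IsProper (D : Digraph V) (κ : V → ℕ) : Prop :=
  ∀ u v, D.toSimpleGraphInclusive.Adj u v → κ u ≠ κ v

open Classical in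
/-- `asc(κ)`: the number of directed edges `(u, v)` with `κ(u) < κ(v)`. -/
def asc (D : Digraph V) (κ : V → ℕ) : ℕ :=
  (Finset.univ.filter fun e : V × V => D.Adj e.1 e.2 ∧ κ e.1 < κ e.2).card

/-- The exponent vector of the monomial `x_κ = ∏_v x_{κ(v)}`. -/
def colorExponent (κ : V → ℕ) : ℕ →₀ ℕ := ∑ v, Finsupp.single (κ v) 1

open Classical in
/-- The chromatic quasisymmetric function `∑_κ t ^ asc(κ) x_κ` over all proper colourings `κ`, as a
power series over `ℚ[t]`. The coefficient of `x ^ m` sums over the proper colourings with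
`x_κ = x ^ m`; these take only colours in the support of `m`. -/
def chromaticQSym (D : Digraph V) : MvPowerSeries ℕ (Polynomial ℚ) := fun m =>
  ∑ κ ∈ (Fintype.piFinset fun _ : V => m.support).filter
    (fun κ => IsProper D κ ∧ colorExponent κ = m), Polynomial.X ^ asc D κ

end Digraph

section Permutation

variable {n : ℕ}

open Classical in
/-- `inv_D(σ)`: the number of directed edges `(u, v)` such that `v` precedes `u` in the word
`σ(0) σ(1) ⋯ σ(n-1)`. -/
def digraphInv (D : Digraph (Fin n)) (σ : Equiv.Perm (Fin n)) : ℕ :=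
  (Finset.univ.filter fun e : Fin n × Fin n =>
    D.Adj e.1 e.2 ∧ σ.symm e.2 < σ.symm e.1).card

/-- The `(G, σ)`-rank of `x`: the length of the longest subword of `σ` that ends in `x` and whose
consecutive letters are adjacent in `G`. A subword is given by the list `l` of its positions. -/
def graphRank (G : SimpleGraph (Fin n)) (σ : Equiv.Perm (Fin n)) (x : Fin n) : ℕ :=
  sSup {k | ∃ l : List (Fin n), l.length = k ∧
    l.IsChain (fun i j => i < j ∧ G.Adj (σ i) (σ j)) ∧ l.getLast? = some (σ.symm x)}

/-- `σ` has a `G`-descent at position `i`, i.e. between the positions `i` and `i + 1`. -/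
def IsGDescent (G : SimpleGraph (Fin n)) (σ : Equiv.Perm (Fin n)) (i : Fin n) : Prop :=
  ∃ j : Fin n, (j : ℕ) = i + 1 ∧
    (graphRank G σ (σ j) < graphRank G σ (σ i) ∨
      graphRank G σ (σ i) = graphRank G σ (σ j) ∧ σ j < σ i)

/-- The letter at position `j` is a `G`-isolated letter of the segment of `σ` that starts at
position `a`: it is not the first letter of the segment, and no earlier letter of the segment is
adjacent to it. -/
def IsGIsolated (G : SimpleGraph (Fin n)) (σ : Equiv.Perm (Fin n)) (a : ℕ) (j : Fin n) : Prop :=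
  a < j ∧ ∀ k : Fin n, a ≤ k → k < j → ¬ G.Adj (σ k) (σ j)

/-- `s_i = μ_1 + ⋯ + μ_i`, where `μ_1 ≥ μ_2 ≥ ⋯` are the parts of `μ`. -/
def partialSum (μ : n.Partition) (i : ℕ) : ℕ := ((μ.parts.sort (· ≥ ·)).take i).sum

open Classical in
/-- `N_μ(G)`: the permutations `σ` such that, when `σ` is cut into contiguous segments of lengths
`μ_1, μ_2, …`, no segment has a `G`-isolated letter or contains a `G`-descent of `σ`.
The `i`-th segment, `i = 0, 1, …`, occupies the positions `j` with `s_i ≤ j < s_{i+1}`. -/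
def NSet (μ : n.Partition) (G : SimpleGraph (Fin n)) : Finset (Equiv.Perm (Fin n)) :=
  Finset.univ.filter fun σ => ∀ i < μ.parts.card,
    (∀ j : Fin n, partialSum μ i ≤ j → (j : ℕ) < partialSum μ (i + 1) →
      ¬ IsGIsolated G σ (partialSum μ i) j) ∧
    (∀ j : Fin n, partialSum μ i ≤ j → (j : ℕ) + 1 < partialSum μ (i + 1) →
      ¬ IsGDescent G σ j)

end Permutation

end ChromQSym

end

/-! By Newton's identities `p_k = ∑ (-1)^(ℓ(α)+1) α_1 h_α`, the sum running over the compositions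
`α` of `k`, and the Hall pairing of a symmetric function with `h_α` is its coefficient at `x^α`.
Pairing with `p_μ` is thus a signed sum of coefficients: spread the variables over cells `(i, a)`,
one row per part, and weight each row of exponents by `rowWeight`. This is `rowFunctional`. It is
defined on every power series, so it can be evaluated on `p_ρ` and on `X` by direct counting.

Both evaluations come from `sum_prod_rowWeight`. A map to the cells that increases strictly along an
acyclic relation consists of a weakly increasing map to the rows and, in each row, a strict
labeling. The signed sum of the labelings of one row collapses by inclusion-exclusion over the
subsets of the sources, and survives only if the row has exactly one source (`sum_packed_marked`).
With the empty relation this is the orthogonality `⟨p_ρ, p_μ⟩ = z_μ δ` (`rowFunctional_psumPart`).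
Summed over the acyclic orientations of `G`, it shows that `X` pairs with `p_μ`, up to the sign `∏
(-1)^(μ_i+1)`, to a count of pairs of an acyclic orientation and an ordered partition into blocks
with one source each (`rowFunctional_chromaticQSym`).

Such pairs correspond to the elements of `N_μ(G)`: a permutation gives the orientation by position
and the partition into segments, and is recovered by sorting the vertices by block, rank and label
(`sum_NSet`).

Over `ℚ[t]` the `p_μ` span, so the pairings give the expansion of a symmetric `X`. Finally `ω p_k =
(-1)^(k+1) p_k` cancels the sign. -/

noncomputable section

namespace ChromQSym

open MvPowerSeries Finsupp

/-! ### Signed sums over strict labelings of one row. -/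

section Packed

variable {J : Type*} {R : Type*} [CommRing R]

theorem neg_one_pow_card_sdiff [DecidableEq J] {S U : Finset J} (h : S ⊆ U) :
    (-1 : R) ^ (U \ S).card = (-1) ^ U.card * (-1) ^ S.card := by
  have := Finset.card_sdiff_add_card_eq_card h
  rw [← this, pow_add, mul_assoc, neg_one_pow_mul_self, mul_one]

/-- The coefficient of `ν j` is the alternating count of the subsets of `M` that contain `j`, which
vanishes unless `M = {j}`. -/
theorem sum_powerset_neg_one_pow_mul_sum [DecidableEq J] (M : Finset J) (ν : J → R) :
    ∑ S ∈ M.powerset, (-1) ^ S.card * ∑ j ∈ S, ν j =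
      if M.card = 1 then -∑ j ∈ M, ν j else 0 := by
  induction M using Finset.induction_on with
  | empty => simp
  | insert a M ha ih =>
    rw [Finset.sum_powerset_insert ha, ih]
    have h1 : ∀ S ∈ M.powerset, (-1 : R) ^ (insert a S).card * ∑ j ∈ insert a S, ν j =
        -((-1) ^ S.card * ν a) - (-1) ^ S.card * ∑ j ∈ S, ν j := by
      intro S hS
      have haS : a ∉ S := fun h => ha (Finset.mem_powerset.1 hS h)
      rw [Finset.card_insert_of_notMem haS, Finset.sum_insert haS]
      ring
    rw [Finset.sum_congr rfl h1, Finset.sum_sub_distrib, ih, Finset.sum_neg_distrib,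
      ← Finset.sum_mul, Finset.card_insert_of_notMem ha]
    rcases M.eq_empty_or_nonempty with rfl | hM
    · simp
    · have h3 := Finset.sum_powerset_neg_one_pow_card_of_nonempty hM
      have h4 : ∑ S ∈ M.powerset, (-1 : R) ^ S.card = 0 := by
        exact_mod_cast congrArg (Int.cast : ℤ → R) h3
      have := hM.card_pos
      rw [h4, if_neg (by omega : ¬ M.card + 1 = 1)]
      ring

open Classical in
/-- The elements of `U` with no `o`-predecessor in `U`. -/
def sources (o : J → J → Prop) (U : Finset J) : Finset J := U.filter fun v => ∀ u ∈ U, ¬ o u v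

theorem mem_sources {o : J → J → Prop} {U : Finset J} {v : J} :
    v ∈ sources o U ↔ v ∈ U ∧ ∀ u ∈ U, ¬ o u v := by
  simp [sources]

theorem sources_nonempty {o : J → J → Prop} {f : J → ℕ} (hf : ∀ u v, o u v → f u < f v)
    {U : Finset J} (hU : U.Nonempty) : (sources o U).Nonempty := by
  obtain ⟨v, hv, hmin⟩ := U.exists_min_image f hU
  exact ⟨v, mem_sources.2 ⟨hv, fun u hu huv => by have := hmin u hu; have := hf _ _ huv; omega⟩⟩

theorem sources_subset (o : J → J → Prop) (U : Finset J) : sources o U ⊆ U :=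
  fun _ h => (mem_sources.1 h).1

/-- The weight of the only source of `U`, or `0` if `U` does not have exactly one source. -/
def sourceWeight (o : J → J → Prop) (ν : J → ℕ) (U : Finset J) : ℕ :=
  if (sources o U).card = 1 then ∑ j ∈ sources o U, ν j else 0

variable [Fintype J]

open Classical in
/-- The labelings of `U` by positive integers that are strictly increasing along `o` and whose
labels fill an initial segment of the positive integers; they are extended by `0` off `U`. -/
def packed (o : J → J → Prop) (U : Finset J) : Finset (J → ℕ) :=
  (Fintype.piFinset fun _ => Finset.range (Fintype.card J + 1)).filter fun ψ =>
    (∀ j, ψ j ≠ 0 ↔ j ∈ U) ∧ (∀ j a, 0 < a → a ≤ ψ j → ∃ j', ψ j' = a) ∧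
      ∀ u ∈ U, ∀ v ∈ U, o u v → ψ u < ψ v

/-- Shows that the range bound in `packed`, there only for finiteness, excludes nothing, and later
that the labels fit into the columns. -/
theorem le_card_of_filled {ψ : J → ℕ} (h : ∀ j a, 0 < a → a ≤ ψ j → ∃ j', ψ j' = a) (j : J) :
    ψ j ≤ Fintype.card J := by
  classical
  have h1 : Finset.Icc 1 (ψ j) ⊆ Finset.univ.image ψ := fun a ha => by
    rw [Finset.mem_Icc] at ha
    obtain ⟨j', hj'⟩ := h j a ha.1 ha.2
    exact Finset.mem_image.2 ⟨j', Finset.mem_univ _, hj'⟩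
  have h2 := (Finset.card_le_card h1).trans Finset.card_image_le
  simpa using h2

theorem mem_packed {o : J → J → Prop} {U : Finset J} {ψ : J → ℕ} :
    ψ ∈ packed o U ↔ (∀ j, ψ j ≠ 0 ↔ j ∈ U) ∧ (∀ j a, 0 < a → a ≤ ψ j → ∃ j', ψ j' = a) ∧
      ∀ u ∈ U, ∀ v ∈ U, o u v → ψ u < ψ v := by
  classical
  rw [packed, Finset.mem_filter, and_iff_right_iff_imp]
  rintro ⟨-, h, -⟩
  simpa [Nat.lt_succ_iff] using le_card_of_filled h

/-- The largest label. -/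
def height (ψ : J → ℕ) : ℕ := Finset.univ.sup ψ

theorem card_image_erase_zero [DecidableEq J] {ψ : J → ℕ}
    (h : ∀ j a, 0 < a → a ≤ ψ j → ∃ j', ψ j' = a) :
    ((Finset.univ.image ψ).erase 0).card = height ψ := by
  have : (Finset.univ.image ψ).erase 0 = Finset.Icc 1 (height ψ) := by
    ext a
    simp only [Finset.mem_erase, Finset.mem_image, Finset.mem_univ, true_and, Finset.mem_Icc]
    constructor
    · rintro ⟨h0, j, rfl⟩
      exact ⟨by omega, Finset.le_sup (f := ψ) (Finset.mem_univ j)⟩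
    · rintro ⟨h0, h1⟩
      have : ∃ j, a ≤ ψ j := by
        by_contra! hc
        have : height ψ < a := (Finset.sup_lt_iff (show ⊥ < a from h0)).2 fun j _ => hc j
        omega
      obtain ⟨j, hj⟩ := this
      exact ⟨by omega, h j a h0 hj⟩
  rw [this, Nat.card_Icc]; omega

theorem height_pred (ψ : J → ℕ) : height (fun j => ψ j - 1) = height ψ - 1 := by
  apply le_antisymm
  · refine Finset.sup_le fun j _ => ?_
    have : ψ j ≤ height ψ := Finset.le_sup (f := ψ) (Finset.mem_univ j)
    omega
  · have : height ψ ≤ height (fun j => ψ j - 1) + 1 := Finset.sup_le fun j _ => by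
      have : ψ j - 1 ≤ height (fun j => ψ j - 1) :=
        Finset.le_sup (f := fun j => ψ j - 1) (Finset.mem_univ j)
      omega
    omega

open Classical in
-- Peels off the set `S` of elements labeled 1. It is nonempty since the labels fill an initial
-- segment, and it consists of sources since a predecessor would need a smaller positive label.
-- Lowering all labels by one leaves a packed labeling of `U \ S` of height one less. Conversely,
-- any nonempty set of sources can be put below a packed labeling of the rest.
theorem sum_packed_eq_sum_sources (o : J → J → Prop) {U : Finset J} (hU : U.Nonempty)
    (F : Finset J → R) :
    ∑ ψ ∈ packed o U, (-1) ^ height ψ * F (Finset.univ.filter fun j => ψ j = 1) =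
      -∑ S ∈ (sources o U).powerset.erase ∅,
        F S * ∑ ψ ∈ packed o (U \ S), (-1) ^ height ψ := by
  have hmap : ∀ ψ ∈ packed o U, (Finset.univ.filter fun j => ψ j = 1) ∈
      (sources o U).powerset.erase ∅ := by
    intro ψ hψ
    rw [mem_packed] at hψ
    obtain ⟨h1, h2, h3⟩ := hψ
    rw [Finset.mem_erase, Finset.mem_powerset]
    constructor
    · obtain ⟨j, hj⟩ := hU
      obtain ⟨j', hj'⟩ := h2 j 1 one_pos (Nat.one_le_iff_ne_zero.2 ((h1 j).2 hj))
      exact Finset.ne_empty_of_mem (Finset.mem_filter.2 ⟨Finset.mem_univ j', hj'⟩)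
    · intro v hv
      simp only [Finset.mem_filter, Finset.mem_univ, true_and] at hv
      have hvU : v ∈ U := (h1 v).1 (by omega)
      refine mem_sources.2 ⟨hvU, fun u hu huv => ?_⟩
      have := h3 u hu v hvU huv
      have := (h1 u).2 hu
      omega
  rw [← Finset.sum_fiberwise_of_maps_to hmap, ← Finset.sum_neg_distrib]
  refine Finset.sum_congr rfl fun S hS => ?_
  rw [Finset.mem_erase, Finset.mem_powerset] at hS
  obtain ⟨hS0, hSM⟩ := hS
  have hSU : ∀ j ∈ S, j ∈ U := fun j hj => (mem_sources.1 (hSM hj)).1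
  obtain ⟨s, hs⟩ := Finset.nonempty_iff_ne_empty.2 hS0
  rw [Finset.mul_sum, ← Finset.sum_neg_distrib]
  refine Finset.sum_bij' (fun ψ _ j => ψ j - 1) (fun ψ _ j => if j ∈ U then ψ j + 1 else 0)
    ?_ ?_ ?_ ?_ ?_
  · intro ψ hψ
    rw [Finset.mem_filter, mem_packed] at hψ
    obtain ⟨⟨h1, h2, h3⟩, h4⟩ := hψ
    have h4' : ∀ j, ψ j = 1 ↔ j ∈ S := fun j => by simp [← h4]
    rw [mem_packed]
    refine ⟨fun j => ?_, fun j a ha hj => ?_, fun u hu v hv huv => ?_⟩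
    · rw [Finset.mem_sdiff, ← h4', ← h1]; omega
    · obtain ⟨j', hj'⟩ := h2 j (a + 1) (by omega) (by omega)
      exact ⟨j', by omega⟩
    · rw [Finset.mem_sdiff, ← h4', ← h1] at hu hv
      have := h3 u ((h1 u).1 hu.1) v ((h1 v).1 hv.1) huv
      omega
  · intro ψ hψ
    rw [mem_packed] at hψ
    obtain ⟨h1, h2, h3⟩ := hψ
    rw [Finset.mem_filter, mem_packed]
    refine ⟨⟨fun j => ?_, fun j a ha hj => ?_, fun u hu v hv huv => ?_⟩, ?_⟩
    · split_ifs with h <;> simp [h]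
    · split_ifs at hj with h
      · by_cases ha1 : a = 1
        · refine ⟨s, ?_⟩
          have : ψ s = 0 := by
            by_contra hc; exact (Finset.mem_sdiff.1 ((h1 s).1 hc)).2 hs
          rw [if_pos (hSU s hs), this, ha1]
        · obtain ⟨j', hj'⟩ := h2 j (a - 1) (by omega) (by omega)
          refine ⟨j', ?_⟩
          rw [if_pos (Finset.mem_sdiff.1 ((h1 j').1 (by omega))).1]; omega
      · omega
    · rw [if_pos hu, if_pos hv]
      have hvS : v ∉ S := fun h => (mem_sources.1 (hSM h)).2 u hu huv
      have hv' : v ∈ U \ S := Finset.mem_sdiff.2 ⟨hv, hvS⟩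
      by_cases huS : u ∈ S
      · have h5 : ψ u = 0 := by
          by_contra hc; exact (Finset.mem_sdiff.1 ((h1 u).1 hc)).2 huS
        have := (h1 v).2 hv'
        omega
      · have := h3 u (Finset.mem_sdiff.2 ⟨hu, huS⟩) v hv' huv
        omega
    · ext j
      simp only [Finset.mem_filter, Finset.mem_univ, true_and]
      have := h1 j
      rw [Finset.mem_sdiff] at this
      by_cases hj : j ∈ U
      · rw [if_pos hj]
        have : ψ j = 0 ↔ j ∈ S := by tauto
        rw [← this]; omega
      · rw [if_neg hj]
        exact ⟨fun h => by omega, fun h => absurd (hSU j h) hj⟩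
  · intro ψ hψ
    rw [Finset.mem_filter, mem_packed] at hψ
    ext j
    have := hψ.1.1 j
    dsimp only
    split_ifs with h
    · have := this.2 h; omega
    · by_contra hc; exact h (this.1 (Ne.symm hc))
  · intro ψ hψ
    rw [mem_packed] at hψ
    ext j
    have := hψ.1 j
    dsimp only
    split_ifs with h
    · omega
    · by_contra hc
      exact h (Finset.mem_sdiff.1 (this.1 (by omega))).1
  · intro ψ hψ
    rw [Finset.mem_filter] at hψ
    obtain ⟨hψ, h4⟩ := hψ
    rw [h4, height_pred]
    have h4' : ψ s = 1 := by
      have : s ∈ Finset.univ.filter fun j => ψ j = 1 := by rw [h4]; exact hs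
      simpa using this
    have : ψ s ≤ height ψ := Finset.le_sup (f := ψ) (Finset.mem_univ s)
    obtain ⟨h, hh⟩ : ∃ h, height ψ = h + 1 := ⟨height ψ - 1, by omega⟩
    rw [hh, Nat.add_sub_cancel, pow_succ]
    ring

/-- By induction, peeling leaves `-(-1)^|U|` times the alternating sum over the nonempty sets of
sources. That sum is `-1`, because acyclicity, witnessed by `f`, provides a source. -/
theorem sum_packed {o : J → J → Prop} {f : J → ℕ} (hf : ∀ u v, o u v → f u < f v)
    (U : Finset J) : ∑ ψ ∈ packed o U, (-1 : R) ^ height ψ = (-1) ^ U.card := by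
  classical
  induction U using Finset.strongInduction with
  | H U ih =>
    rcases U.eq_empty_or_nonempty with rfl | hU
    · have : packed o ∅ = {fun _ => 0} := by
        ext ψ
        rw [mem_packed, Finset.mem_singleton]
        constructor
        · rintro ⟨h, -⟩
          ext j
          simpa using h j
        · rintro rfl
          simp only [ne_eq, not_true_eq_false, Finset.notMem_empty, implies_true, true_and,
            IsEmpty.forall_iff, and_true]
          intro j a ha hj
          omega
      rw [this, Finset.sum_singleton]
      have : height (fun _ : J => 0) = 0 := Nat.le_zero.1 (Finset.sup_le fun _ _ => le_rfl)
      rw [this, Finset.card_empty]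
    · have h1 := sum_packed_eq_sum_sources o hU fun _ => (1 : R)
      simp only [mul_one, one_mul] at h1
      rw [h1]
      have h2 : ∑ S ∈ (sources o U).powerset.erase ∅, ∑ ψ ∈ packed o (U \ S), (-1 : R) ^ height ψ =
          ∑ S ∈ (sources o U).powerset.erase ∅, (-1) ^ U.card * (-1) ^ S.card := by
        refine Finset.sum_congr rfl fun S hS => ?_
        rw [Finset.mem_erase, Finset.mem_powerset] at hS
        have hSU := hS.2.trans (sources_subset o U)
        rw [ih _ (Finset.sdiff_ssubset hSU (Finset.nonempty_iff_ne_empty.2 hS.1)),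
          neg_one_pow_card_sdiff hSU]
      rw [h2, ← Finset.mul_sum, Finset.sum_erase_eq_sub (Finset.empty_mem_powerset _)]
      have h3 := Finset.sum_powerset_neg_one_pow_card_of_nonempty (sources_nonempty hf hU)
      have h4 : ∑ S ∈ (sources o U).powerset, (-1 : R) ^ S.card = 0 := by
        exact_mod_cast congrArg (Int.cast : ℤ → R) h3
      rw [h4]
      simp

open Classical in
-- Peel once with the weight `∑ j ∈ S, ν j` and evaluate the rest by `sum_packed`. The weighted
-- alternating sum over sets of sources then vanishes unless there is a single source.
theorem sum_packed_marked {o : J → J → Prop} {f : J → ℕ} (hf : ∀ u v, o u v → f u < f v)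
    (ν : J → ℕ) (U : Finset J) :
    ∑ ψ ∈ packed o U, (-1 : R) ^ (height ψ + 1) *
      ((∑ j ∈ Finset.univ.filter fun j => ψ j = 1, ν j : ℕ) : R) =
      (-1) ^ (U.card + 1) * (sourceWeight o ν U : R) := by
  rcases U.eq_empty_or_nonempty with rfl | hU
  · have h1 : sources o ∅ = ∅ := by simp [sources]
    rw [sourceWeight, h1]
    simp only [Finset.card_empty, zero_ne_one, if_false, Nat.cast_zero, mul_zero]
    refine Finset.sum_eq_zero fun ψ hψ => ?_
    rw [mem_packed] at hψ
    rw [Finset.filter_false_of_mem]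
    · simp
    · intro j _ h
      simpa using (hψ.1 j).1 (by omega)
  · have h1 := sum_packed_eq_sum_sources o hU fun S => ((∑ j ∈ S, ν j : ℕ) : R)
    simp only [pow_succ, mul_neg_one, neg_mul, Finset.sum_neg_distrib]
    rw [h1, neg_neg]
    have h2 : ∀ S ∈ (sources o U).powerset.erase ∅, ((∑ j ∈ S, ν j : ℕ) : R) *
        ∑ ψ ∈ packed o (U \ S), (-1 : R) ^ height ψ =
        (-1) ^ U.card * ((-1) ^ S.card * ∑ j ∈ S, (ν j : R)) := by
      intro S hS
      rw [Finset.mem_erase, Finset.mem_powerset] at hS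
      rw [sum_packed hf, neg_one_pow_card_sdiff (hS.2.trans (sources_subset o U))]
      push_cast
      ring
    rw [Finset.sum_congr rfl h2, ← Finset.mul_sum,
      Finset.sum_erase_eq_sub (Finset.empty_mem_powerset _), sum_powerset_neg_one_pow_mul_sum,
      sourceWeight]
    split_ifs <;> simp

end Packed

/-! ### Row weights and maps to the cells. -/

section Rows

variable {l N : ℕ} {J : Type*}

open Classical in
/-- The weight of a row `m` of exponents: it vanishes unless the sum of the row is `k` and its
nonzero entries form an initial segment. -/
def rowWeight (k : ℕ) (m : Fin N → ℕ) : ℤ :=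
  if (∀ a b, b ≤ a → m a ≠ 0 → m b ≠ 0) ∧ ∑ a, m a = k then
    (-1) ^ ((Finset.univ.filter fun a => m a ≠ 0).card + 1) *
      ((∑ a ∈ Finset.univ.filter fun a : Fin N => (a : ℕ) = 0, m a : ℕ) : ℤ)
  else 0

/-- The labels of the row `i` of a map to the cells `(i, a)`; the label is `0` off that row. -/
def rowLabel (ψ : J → Fin l × Fin N) (i : Fin l) (j : J) : ℕ :=
  if (ψ j).1 = i then (ψ j).2 + 1 else 0

theorem rowLabel_eq_succ (ψ : J → Fin l × Fin N) (i : Fin l) (j : J) (a : Fin N) :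
    rowLabel ψ i j = a + 1 ↔ ψ j = (i, a) := by
  rw [rowLabel]
  split_ifs with h
  · rw [Prod.ext_iff, Fin.ext_iff (b := (i, a).2)]; simp [h]
  · exact ⟨fun h' => h'.elim, fun h' => absurd (by rw [h']) h⟩

variable [Fintype J]

/-- The weighted content of a map to the cells. -/
def content {I : Type*} (ν : J → ℕ) (ψ : J → I) : I →₀ ℕ := ∑ j, Finsupp.single (ψ j) (ν j)

theorem content_apply {I : Type*} [DecidableEq I] (ν : J → ℕ) (ψ : J → I) (x : I) :
    content ν ψ x = ∑ j ∈ Finset.univ.filter fun j => ψ j = x, ν j := by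
  rw [content, Finsupp.finsetSum_apply, Finset.sum_filter]
  exact Finset.sum_congr rfl fun j _ => by rw [Finsupp.single_apply]

theorem content_apply_ne_zero {I : Type*} {ν : J → ℕ} (hν : ∀ j, 0 < ν j) (ψ : J → I) (x : I) :
    content ν ψ x ≠ 0 ↔ ∃ j, ψ j = x := by
  classical
  rw [content_apply, Ne, Finset.sum_eq_zero_iff]
  simp only [Finset.mem_filter, Finset.mem_univ, true_and, not_forall]
  exact ⟨fun ⟨j, hj, _⟩ => ⟨j, hj⟩, fun ⟨j, hj⟩ => ⟨j, hj, (hν j).ne'⟩⟩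

open Classical in
-- As `ν` is positive, the nonzero entries of the row are the occupied columns. Their number is the
-- height of the labeling, and the entry in column 0 is the weight of the elements labeled 1.
theorem rowWeight_content {ν : J → ℕ} (hν : ∀ j, 0 < ν j) (ψ : J → Fin l × Fin N) (i : Fin l)
    (k : ℕ) : rowWeight k (fun a => content ν ψ (i, a)) =
      if (∀ j a, 0 < a → a ≤ rowLabel ψ i j → ∃ j', rowLabel ψ i j' = a) ∧
          ∑ j ∈ Finset.univ.filter fun j => (ψ j).1 = i, ν j = k then
        (-1) ^ (height (rowLabel ψ i) + 1) *
          ((∑ j ∈ Finset.univ.filter fun j => rowLabel ψ i j = 1, ν j : ℕ) : ℤ)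
      else 0 := by
  have h1 : (∀ a b : Fin N, b ≤ a → content ν ψ (i, a) ≠ 0 → content ν ψ (i, b) ≠ 0) ↔
      ∀ j a, 0 < a → a ≤ rowLabel ψ i j → ∃ j', rowLabel ψ i j' = a := by
    simp only [content_apply_ne_zero hν]
    constructor
    · intro h j a ha haj
      have hj : rowLabel ψ i j ≠ 0 := by omega
      have hj1 : (ψ j).1 = i := by
        by_contra hc; exact hj (if_neg hc)
      have hj2 : rowLabel ψ i j = (ψ j).2 + 1 := if_pos hj1
      obtain ⟨j', hj'⟩ := h (ψ j).2 ⟨a - 1, by omega⟩ (Fin.le_def.2 (by simp only; omega))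
        ⟨j, by rw [← hj1]⟩
      refine ⟨j', ?_⟩
      rw [(rowLabel_eq_succ ψ i j' _).2 hj']
      simp only
      omega
    · rintro h a b hba ⟨j, hj⟩
      have := (rowLabel_eq_succ ψ i j a).2 hj
      have hba' : (b : ℕ) ≤ a := hba
      obtain ⟨j', hj'⟩ := h j (b + 1) (by omega) (by omega)
      exact ⟨j', (rowLabel_eq_succ ψ i j' b).1 hj'⟩
  have h2 : ∑ a, content ν ψ (i, a) = ∑ j ∈ Finset.univ.filter fun j => (ψ j).1 = i, ν j := by
    rw [← Finset.sum_fiberwise_of_maps_to (t := Finset.univ) (g := fun j => (ψ j).2)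
      (fun _ _ => Finset.mem_univ _)]
    refine Finset.sum_congr rfl fun a _ => ?_
    rw [content_apply, Finset.filter_filter]
    simp only [Prod.ext_iff]
  rw [rowWeight]
  by_cases hc : (∀ j a, 0 < a → a ≤ rowLabel ψ i j → ∃ j', rowLabel ψ i j' = a) ∧
      ∑ j ∈ Finset.univ.filter fun j => (ψ j).1 = i, ν j = k
  · rw [if_pos hc, if_pos ⟨h1.2 hc.1, h2.trans hc.2⟩]
    have h3 : (Finset.univ.filter fun a => content ν ψ (i, a) ≠ 0).card =
        height (rowLabel ψ i) := by
      rw [← card_image_erase_zero hc.1]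
      refine Finset.card_bij (fun a _ => (a : ℕ) + 1) ?_ ?_ ?_
      · intro a ha
        simp only [Finset.mem_filter, Finset.mem_univ, true_and, content_apply_ne_zero hν] at ha
        obtain ⟨j, hj⟩ := ha
        refine Finset.mem_erase.2 ⟨by omega, Finset.mem_image.2 ⟨j, Finset.mem_univ _, ?_⟩⟩
        exact (rowLabel_eq_succ ψ i j a).2 hj
      · intro a _ b _ hab
        exact Fin.ext (by omega)
      · intro b hb
        obtain ⟨hb0, hb⟩ := Finset.mem_erase.1 hb
        obtain ⟨j, -, rfl⟩ := Finset.mem_image.1 hb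
        have hj1 : (ψ j).1 = i := by
          by_contra hc; exact hb0 (if_neg hc)
        refine ⟨(ψ j).2, ?_, (if_pos hj1).symm⟩
        simp only [Finset.mem_filter, Finset.mem_univ, true_and, content_apply_ne_zero hν]
        exact ⟨j, by rw [← hj1]⟩
    have h4 : ∑ a ∈ Finset.univ.filter fun a : Fin N => (a : ℕ) = 0, content ν ψ (i, a) =
        ∑ j ∈ Finset.univ.filter fun j => rowLabel ψ i j = 1, ν j := by
      rw [← Finset.sum_fiberwise_of_maps_to
        (t := Finset.univ.filter fun a : Fin N => (a : ℕ) = 0) (g := fun j => (ψ j).2)]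
      · refine Finset.sum_congr rfl fun a ha => ?_
        rw [content_apply, Finset.filter_filter]
        refine Finset.sum_congr (Finset.filter_congr fun j _ => ?_) fun _ _ => rfl
        simp only [Finset.mem_filter, Finset.mem_univ, true_and] at ha
        have := rowLabel_eq_succ ψ i j a
        rw [ha, zero_add] at this
        rw [this]
        exact ⟨fun h => ⟨h, by rw [h]⟩, fun h => h.1⟩
      · intro j hj
        simp only [Finset.mem_filter, Finset.mem_univ, true_and] at hj ⊢
        rw [rowLabel] at hj
        split_ifs at hj
        omega
    rw [h3, h4]
  · rw [if_neg hc, if_neg fun h => hc ⟨h1.1 h.1, h2.symm.trans h.2⟩]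

open Classical in
/-- The sum of the products of the row weights over all maps to the cells that are strictly
increasing along an acyclic relation `o`. -/
theorem sum_prod_rowWeight {o : J → J → Prop} {f : J → ℕ} (hf : ∀ u v, o u v → f u < f v)
    {ν : J → ℕ} (hν : ∀ j, 0 < ν j) (hN : Fintype.card J ≤ N) (μ : Fin l → ℕ) :
    ∑ ψ ∈ (Finset.univ : Finset (J → Fin l × Fin N)).filter
        (fun ψ => ∀ u v, o u v → toLex (ψ u) < toLex (ψ v)),
      ∏ i, rowWeight (μ i) (fun a => content ν ψ (i, a)) =
    ∑ β ∈ (Finset.univ : Finset (J → Fin l)).filter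
        (fun β => (∀ u v, o u v → β u ≤ β v) ∧
          ∀ i, ∑ j ∈ Finset.univ.filter (fun j => β j = i), ν j = μ i),
      ∏ i, ((-1) ^ ((Finset.univ.filter fun j => β j = i).card + 1) *
        (sourceWeight o ν (Finset.univ.filter fun j => β j = i) : ℤ)) := by
  have hdrop : ∑ ψ ∈ (Finset.univ : Finset (J → Fin l × Fin N)).filter
        (fun ψ => ∀ u v, o u v → toLex (ψ u) < toLex (ψ v)),
      ∏ i, rowWeight (μ i) (fun a => content ν ψ (i, a)) =
      ∑ ψ ∈ ((Finset.univ : Finset (J → Fin l × Fin N)).filter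
        (fun ψ => ∀ u v, o u v → toLex (ψ u) < toLex (ψ v))).filter
          (fun ψ => ∀ i, (∀ j a, 0 < a → a ≤ rowLabel ψ i j → ∃ j', rowLabel ψ i j' = a) ∧
            ∑ j ∈ Finset.univ.filter fun j => (ψ j).1 = i, ν j = μ i),
        ∏ i, ((-1) ^ (height (rowLabel ψ i) + 1) *
          ((∑ j ∈ Finset.univ.filter fun j => rowLabel ψ i j = 1, ν j : ℕ) : ℤ)) := by
    rw [eq_comm, Finset.sum_filter, eq_comm]
    refine Finset.sum_congr rfl fun ψ _ => ?_
    simp only [rowWeight_content hν]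
    split_ifs with h
    · exact Finset.prod_congr rfl fun i _ => if_pos (h i)
    · push Not at h
      obtain ⟨i, hi⟩ := h
      exact Finset.prod_eq_zero (Finset.mem_univ i) (if_neg fun h' => hi h'.1 h'.2)
  rw [hdrop]
  -- For a fixed map `β` to the rows, a relation between different rows holds strictly already in
  -- the first coordinate. Only relations inside a fiber of `β` constrain the columns, so the sum
  -- factors over the rows.
  rw [← Finset.sum_fiberwise_of_maps_to (g := fun ψ j => (ψ j).1)
    (t := (Finset.univ : Finset (J → Fin l)).filter
        (fun β => (∀ u v, o u v → β u ≤ β v) ∧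
          ∀ i, ∑ j ∈ Finset.univ.filter (fun j => β j = i), ν j = μ i))]
  · refine Finset.sum_congr rfl fun β hβ => ?_
    simp only [Finset.mem_filter, Finset.mem_univ, true_and] at hβ
    obtain ⟨hmono, hsum⟩ := hβ
    simp only [← sum_packed_marked (R := ℤ) hf]
    rw [Finset.prod_univ_sum]
    have hpos : ∀ p ∈ Fintype.piFinset fun i => packed o (Finset.univ.filter fun j => β j = i),
        ∀ i j, p i j ≠ 0 ↔ β j = i := by
      intro p hp i j
      have := (mem_packed.1 (Fintype.mem_piFinset.1 hp i)).1 j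
      simpa using this
    have hlab : ∀ p ∈ Fintype.piFinset fun i => packed o (Finset.univ.filter fun j => β j = i),
        ∀ h : ∀ j, p (β j) j - 1 < N,
        rowLabel (fun j => (β j, (⟨p (β j) j - 1, h j⟩ : Fin N))) = p := by
      intro p hp h
      ext i j
      have h1 := hpos p hp i j
      rw [rowLabel]
      split_ifs with hb
      · have h2 := h1.2 hb
        simp only at hb ⊢
        subst hb
        omega
      · simp only at hb
        by_contra hc
        exact hb (h1.1 (Ne.symm hc))
    -- The column is the label minus one. It is smaller than `N` because a packed label is at most
    -- the cardinality of `J`.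
    refine Finset.sum_bij' (fun ψ _ => rowLabel ψ)
      (fun p hp j => (β j, ⟨p (β j) j - 1, ?_⟩)) ?_ ?_ ?_ ?_ ?_
    · have h1 := (hpos p hp (β j) j).2 rfl
      have h2 := le_card_of_filled (mem_packed.1 (Fintype.mem_piFinset.1 hp (β j))).2.1 j
      omega
    · intro ψ hψ
      simp only [Finset.mem_filter, Finset.mem_univ, true_and] at hψ
      obtain ⟨⟨hs, hp⟩, rfl⟩ := hψ
      refine Fintype.mem_piFinset.2 fun i => mem_packed.2 ⟨fun j => ?_, (hp i).1, ?_⟩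
      · simp [rowLabel]
      · intro u hu v hv huv
        simp only [Finset.mem_filter, Finset.mem_univ, true_and] at hu hv
        have := hs u v huv
        rw [Prod.Lex.toLex_lt_toLex, hu, hv] at this
        have h2 : (ψ u).2 < (ψ v).2 := by simpa using this
        rw [rowLabel, rowLabel, if_pos hu, if_pos hv]
        have : ((ψ u).2 : ℕ) < (ψ v).2 := h2
        omega
    · intro p hp
      simp only [Finset.mem_filter, Finset.mem_univ, true_and]
      refine ⟨⟨fun u v huv => ?_, fun i => ⟨?_, ?_⟩⟩, trivial⟩
      · rw [Prod.Lex.toLex_lt_toLex]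
        rcases (hmono u v huv).lt_or_eq with h | h
        · exact Or.inl h
        · refine Or.inr ⟨h, ?_⟩
          rw [Fin.mk_lt_mk]
          have h1 := (mem_packed.1 (Fintype.mem_piFinset.1 hp (β v))).2.2 u
            (by simp [h]) v (by simp) huv
          have h2 := (hpos p hp (β v) u).2 h
          rw [h]
          omega
      · rw [hlab p hp]
        exact (mem_packed.1 (Fintype.mem_piFinset.1 hp i)).2.1
      · exact hsum i
    · intro ψ hψ
      simp only [Finset.mem_filter, Finset.mem_univ, true_and] at hψ
      obtain ⟨-, rfl⟩ := hψ
      ext j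
      · rfl
      · simp [rowLabel]
    · intro p hp
      exact hlab p hp _
    · intro ψ hψ
      rfl
  · intro ψ hψ
    simp only [Finset.mem_filter, Finset.mem_univ, true_and] at hψ ⊢
    refine ⟨fun u v huv => ?_, fun i => (hψ.2 i).2⟩
    have := hψ.1 u v huv
    rw [Prod.Lex.toLex_lt_toLex] at this
    rcases this with h | h
    · exact h.le
    · exact h.1.le

end Rows

theorem sources_false {J : Type*} (U : Finset J) : sources (fun _ _ => False) U = U := by
  ext; simp [mem_sources]

/-! ### The pairing functional and its values on products of power sums. -/

section Functional

variable {R : Type*} [CommRing R] {l N : ℕ} {J : Type*} [Fintype J]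

/-- The functional that pairs the coefficients in degree at most `n` with the products of the row
weights, where the cell `(i, a)` stands for the variable with index `e (i, a)`. -/
def rowFunctional (e : Fin l × Fin N ↪ ℕ) (n : ℕ) (μ : Fin l → ℕ) : MvPowerSeries ℕ R →ₗ[R] R :=
  ∑ m ∈ (Finsupp.finite_of_degree_le (σ := Fin l × Fin N) n).toFinset,
    ((∏ i, rowWeight (μ i) (fun a => m (i, a)) : ℤ) : R) • coeff (embDomain e m)

theorem degree_content {I : Type*} (ν : J → ℕ) (ψ : J → I) : (content ν ψ).degree = ∑ j, ν j := by
  rw [content, map_sum]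
  simp

open Classical in
-- Every content has degree `∑ j, ν j`, so the degree bound in the functional loses no map.
theorem rowFunctional_eq_sum (e : Fin l × Fin N ↪ ℕ) (μ : Fin l → ℕ) (ν : J → ℕ)
    (Ψ : Finset (J → Fin l × Fin N)) (g : (J → Fin l × Fin N) → R) {f : MvPowerSeries ℕ R}
    (hf : ∀ m, coeff (embDomain e m) f = ∑ ψ ∈ Ψ.filter fun ψ => content ν ψ = m, g ψ) :
    rowFunctional e (∑ j, ν j) μ f =
      ∑ ψ ∈ Ψ, ((∏ i, rowWeight (μ i) (fun a => content ν ψ (i, a)) : ℤ) : R) * g ψ := by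
  rw [rowFunctional, LinearMap.sum_apply, ← Finset.sum_fiberwise_of_maps_to (g := content ν)
    (t := (Finsupp.finite_of_degree_le (σ := Fin l × Fin N) (∑ j, ν j)).toFinset)]
  · refine Finset.sum_congr rfl fun m _ => ?_
    rw [LinearMap.smul_apply, hf, smul_eq_mul, Finset.mul_sum]
    refine Finset.sum_congr rfl fun ψ hψ => ?_
    rw [(Finset.mem_filter.1 hψ).2]
  · intro ψ _
    simp [degree_content]

theorem killCompl_psum {I : Type*} [Fintype I] (e : I ↪ ℕ) {k : ℕ} (hk : k ≠ 0) :
    killCompl e (psum R k : MvPowerSeries ℕ R) = ∑ x : I, monomial (single x k) 1 := by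
  classical
  ext m
  rw [coeff_killCompl, map_sum]
  simp only [coeff_monomial]
  change (if ∃ i, embDomain e m = single i k then (1 : R) else 0) = _
  split_ifs with h
  · obtain ⟨i, hi⟩ := h
    have hi' : embDomain e m i ≠ 0 := by rw [hi]; simpa using hk
    obtain ⟨x, rfl⟩ : i ∈ Set.range e := by
      by_contra hc; exact hi' (embDomain_of_notMem_range _ _ _ hc)
    rw [← embDomain_single, embDomain_inj] at hi
    rw [Finset.sum_eq_single x, if_pos hi]
    · rintro y - hyx
      refine if_neg fun h => hyx ?_
      rw [hi] at h
      exact (single_left_injective hk h).symm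
    · simp
  · refine (Finset.sum_eq_zero fun x _ => if_neg fun hx => h ⟨e x, ?_⟩).symm
    rw [hx, embDomain_single]

open Classical in
theorem coeff_embDomain_prod_psum (e : Fin l × Fin N ↪ ℕ) {ν : J → ℕ} (hν : ∀ j, 0 < ν j)
    (m : Fin l × Fin N →₀ ℕ) :
    coeff (embDomain e m) ((∏ j, psum R (ν j) : SymFunc R) : MvPowerSeries ℕ R) =
      ∑ _ψ ∈ Finset.univ.filter fun ψ => content ν ψ = m, 1 := by
  rw [← coeff_killCompl, ← Subalgebra.val_apply, map_prod, map_prod]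
  simp only [Subalgebra.val_apply, killCompl_psum e (hν _).ne']
  rw [Finset.prod_univ_sum, Fintype.piFinset_univ, map_sum, Finset.sum_filter]
  refine Finset.sum_congr rfl fun ψ _ => ?_
  rw [prod_monomial, coeff_monomial, Finset.prod_const_one]
  simp only [content, eq_comm]

/-- Expanding the product amounts to choosing a cell for each factor, with no relation to respect.
Every element of a fiber is then a source, so only maps with one-element fibers contribute, each
with sign `+1` and weight `∏ μ i`. -/
theorem rowFunctional_prod_psum (e : Fin l × Fin N ↪ ℕ) (μ : Fin l → ℕ) {ν : J → ℕ}
    (hν : ∀ j, 0 < ν j) (hN : Fintype.card J ≤ N) :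
    rowFunctional e (∑ j, ν j) μ ((∏ j, psum R (ν j) : SymFunc R) : MvPowerSeries ℕ R) =
      (Nat.card {β : J → Fin l // β.Bijective ∧ ∀ j, ν j = μ (β j)} * ∏ i, μ i : ℕ) := by
  classical
  rw [rowFunctional_eq_sum e μ ν Finset.univ _ (coeff_embDomain_prod_psum e hν)]
  have h := sum_prod_rowWeight (o := fun _ _ : J => False) (f := fun _ => 0) (by simp) hν hN μ
  simp only [false_imp_iff, implies_true, Finset.filter_true, true_and] at h
  simp only [mul_one]
  rw [← Int.cast_sum, h, ← Int.cast_natCast (R := R)]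
  congr 1
  push_cast
  rw [Nat.card_eq_fintype_card, Fintype.card_subtype, ← nsmul_eq_mul, ← Finset.sum_const, Finset.sum_filter, Finset.sum_filter]
  refine Finset.sum_congr rfl fun β _ => ?_
  simp only [sourceWeight, sources_false]
  by_cases hβ : ∀ i, (Finset.univ.filter fun j => β j = i).card = 1
  · have hbij : β.Bijective := by
      refine ⟨fun j j' hj => ?_, fun i => ?_⟩
      · exact Finset.card_le_one.1 (hβ (β j')).le _ (by simpa using hj) _ (by simp)
      · obtain ⟨j, hj⟩ := Finset.card_pos.1 (by rw [hβ i]; exact one_pos)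
        exact ⟨j, by simpa using hj⟩
    have hfib : ∀ j, (Finset.univ.filter fun j' => β j' = β j) = {j} := by
      intro j; ext j'; simp [hbij.1.eq_iff]
    have hiff : (∀ i, ∑ j ∈ Finset.univ.filter (fun j => β j = i), ν j = μ i) ↔
        (β.Bijective ∧ ∀ j, ν j = μ (β j)) := by
      constructor
      · intro h
        refine ⟨hbij, fun j => ?_⟩
        rw [← h (β j), hfib, Finset.sum_singleton]
      · rintro ⟨-, h⟩ i
        obtain ⟨j, rfl⟩ := hbij.2 i
        rw [hfib, Finset.sum_singleton, h]
    refine if_ctx_congr hiff (fun hc => Finset.prod_congr rfl fun i _ => ?_) fun _ => rfl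
    rw [if_pos (hβ i), hβ i, hiff.2 hc i]
    norm_num
  · rw [if_neg (c := β.Bijective ∧ _)]
    · split_ifs
      · push Not at hβ
        obtain ⟨i, hi⟩ := hβ
        refine Finset.prod_eq_zero (Finset.mem_univ i) ?_
        rw [if_neg hi]
        simp
      · rfl
    · rintro ⟨hbij, -⟩
      refine hβ fun i => ?_
      obtain ⟨j, rfl⟩ := hbij.2 i
      rw [Finset.card_eq_one]
      exact ⟨j, by ext j'; simp [hbij.1.eq_iff]⟩

end Functional

/-! ### Orthogonality of the power sums. -/

section Partition

variable {n : ℕ}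

/-- The composition of `n` whose blocks are the parts of `μ` in weakly decreasing order. -/
def sortedComposition (μ : n.Partition) : Composition n where
  blocks := μ.parts.sort (· ≥ ·)
  blocks_pos h := μ.parts_pos ((Multiset.mem_sort _).1 h)
  blocks_sum := by
    rw [← Multiset.sum_coe, Multiset.sort_eq, μ.parts_sum]

theorem map_blocksFun_sortedComposition (μ : n.Partition) :
    (Finset.univ.val.map (sortedComposition μ).blocksFun) = μ.parts := by
  have h1 : ((sortedComposition μ).blocks : Multiset ℕ) = μ.parts := Multiset.sort_eq _ _
  rw [← h1, ← Composition.ofFn_blocksFun, Fin.univ_val_map]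

theorem psumPart_eq_prod (R : Type*) [CommRing R] (μ : n.Partition) :
    psumPart R μ = ∏ j, psum R ((sortedComposition μ).blocksFun j) := by
  rw [psumPart, ← map_blocksFun_sortedComposition, Multiset.map_map]
  rfl

/-- The bijections form the stabilizer of the sequence of parts, of order `∏ m_i!`; the product of
the parts is `∏ i ^ m_i`. -/
theorem card_bijective_mul_prod (μ : n.Partition) :
    Nat.card {β : Fin (sortedComposition μ).length → Fin (sortedComposition μ).length //
      β.Bijective ∧ ∀ j, (sortedComposition μ).blocksFun j =
        (sortedComposition μ).blocksFun (β j)} * ∏ i, (sortedComposition μ).blocksFun i =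
      zPart μ := by
  classical
  set c := sortedComposition μ
  have hprod : ∏ i, c.blocksFun i = ∏ k ∈ μ.parts.toFinset, k ^ μ.parts.count k := by
    rw [← Finset.prod_multiset_count, ← map_blocksFun_sortedComposition]
    rfl
  have himg : Finset.univ.image c.blocksFun = μ.parts.toFinset := by
    rw [← map_blocksFun_sortedComposition]
    rfl
  rw [zPart, Finset.prod_mul_distrib, ← hprod]
  congr 1
  have h1 := DomMulAct.stabilizer_card' c.blocksFun
  rw [himg] at h1
  have h2 : Nat.card {β : Fin c.length → Fin c.length //
      β.Bijective ∧ ∀ j, c.blocksFun j = c.blocksFun (β j)} =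
      Fintype.card {g : Equiv.Perm (Fin c.length) // c.blocksFun ∘ g = c.blocksFun} := by
    rw [← Nat.card_eq_fintype_card]
    exact Nat.card_congr
      { toFun := fun β => ⟨Equiv.ofBijective β.1 β.2.1, funext fun j => (β.2.2 j).symm⟩
        invFun := fun g => ⟨g.1, g.1.bijective, fun j => (congrFun g.2 j).symm⟩
        left_inv := fun _ => rfl
        right_inv := fun _ => Subtype.ext (Equiv.ext fun _ => rfl) }
  rw [h2, h1]
  refine Finset.prod_congr rfl fun k _ => ?_
  congr 1
  rw [Fintype.card_subtype, ← map_blocksFun_sortedComposition, Multiset.count_map]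
  simp only [eq_comm (a := k)]
  rfl

/-- A bijection that matches the parts exists only if the multisets of parts agree. The placement
`e` of the cells does not matter, which leaves it free to be chosen for `X`. -/
theorem rowFunctional_psumPart {R : Type*} [CommRing R] (μ ρ : n.Partition)
    (e : Fin (sortedComposition μ).length × Fin n ↪ ℕ) :
    rowFunctional e n (sortedComposition μ).blocksFun (psumPart R ρ : MvPowerSeries ℕ R) =
      if ρ = μ then (zPart μ : R) else 0 := by
  classical
  have h := rowFunctional_prod_psum (R := R) e (sortedComposition μ).blocksFun
    (ν := (sortedComposition ρ).blocksFun) (fun j => (sortedComposition ρ).one_le_blocksFun j)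
    (by rw [Fintype.card_fin]; exact (sortedComposition ρ).length_le)
  rw [(sortedComposition ρ).sum_blocksFun] at h
  rw [psumPart_eq_prod, h]
  split_ifs with hρ
  · subst hρ
    rw [card_bijective_mul_prod]
  · have : IsEmpty {β : Fin (sortedComposition ρ).length → Fin (sortedComposition μ).length //
        β.Bijective ∧ ∀ j, (sortedComposition ρ).blocksFun j =
          (sortedComposition μ).blocksFun (β j)} := by
      refine ⟨fun ⟨β, hbij, hβ⟩ => ?_⟩
      refine hρ (Nat.Partition.ext ?_)
      rw [← map_blocksFun_sortedComposition, ← map_blocksFun_sortedComposition μ,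
        ← Finset.univ_map_equiv_to_embedding (Equiv.ofBijective β hbij), Finset.map_val,
        Multiset.map_map]
      exact Multiset.map_congr rfl fun j _ => hβ j
    rw [Nat.card_of_isEmpty, zero_mul, Nat.cast_zero]

end Partition

/-! ### Acyclic orientations. -/

section Orientation

variable {V : Type*}

/-- The orientation of `G` along which `f` increases. -/
def orientation {α : Type*} [LT α] (G : SimpleGraph V) (f : V → α) (u v : V) : Prop :=
  G.Adj u v ∧ f u < f v

variable [Fintype V]

open Classical in
/-- The acyclic orientations of `G`, as relations. -/
def acyclicOrientations (G : SimpleGraph V) : Finset (V → V → Prop) :=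
  Finset.univ.filter fun o => ∃ f : V → ℕ, (∀ u v, G.Adj u v → f u ≠ f v) ∧ o = orientation G f

theorem mem_acyclicOrientations {G : SimpleGraph V} {o : V → V → Prop} :
    o ∈ acyclicOrientations G ↔
      ∃ f : V → ℕ, (∀ u v, G.Adj u v → f u ≠ f v) ∧ o = orientation G f := by
  simp [acyclicOrientations]

/-- Since `o` directs every edge of `G`, a map that increases along `o` is proper and leaves no edge
free to point the other way. -/
theorem orientation_eq_iff {α : Type*} [LinearOrder α] {G : SimpleGraph V} {o : V → V → Prop}
    (ho : o ∈ acyclicOrientations G) (f : V → α) :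
    ((∀ u v, G.Adj u v → f u ≠ f v) ∧ orientation G f = o) ↔ ∀ u v, o u v → f u < f v := by
  obtain ⟨g, hg, rfl⟩ := mem_acyclicOrientations.1 ho
  constructor
  · rintro ⟨-, h⟩ u v huv
    rw [← h] at huv
    exact huv.2
  · intro h
    have h1 : ∀ u v, G.Adj u v → (f u < f v ↔ g u < g v) := by
      intro u v huv
      rcases lt_or_gt_of_ne (hg u v huv) with h2 | h2
      · exact ⟨fun _ => h2, fun _ => h u v ⟨huv, h2⟩⟩
      · have h3 := h v u ⟨huv.symm, h2⟩
        exact ⟨fun h4 => absurd h4 h3.asymm, fun h4 => absurd h4 h2.asymm⟩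
    refine ⟨fun u v huv hf => ?_, ?_⟩
    · rcases lt_or_gt_of_ne (hg u v huv) with h2 | h2
      · exact ((h1 u v huv).2 h2).ne hf
      · exact ((h1 v u huv.symm).2 h2).ne' hf
    · ext u v
      exact and_congr_right fun huv => h1 u v huv

open Classical in
/-- The number of edges `(u, v)` of `D` that `o` orients from `v` to `u`. -/
def orientationInv (D : Digraph V) (o : V → V → Prop) : ℕ :=
  (Finset.univ.filter fun e : V × V => D.Adj e.1 e.2 ∧ o e.2 e.1).card

theorem orientationInv_orientation {α : Type*} [Preorder α] (D : Digraph V) (f : V → α) :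
    orientationInv D (orientation D.toSimpleGraphInclusive f) =
      Nat.card {e : V × V // D.Adj e.1 e.2 ∧ f e.2 < f e.1} := by
  classical
  rw [Nat.card_eq_fintype_card, Fintype.card_subtype, orientationInv]
  congr 1
  refine Finset.filter_congr fun e _ => and_congr_right fun he => ?_
  refine ⟨fun h => h.2, fun h => ⟨⟨?_, Or.inr he⟩, h⟩⟩
  intro h'
  rw [h'] at h
  exact lt_irrefl _ h

end Orientation

/-! ### Ordered partitions into blocks with one source. -/

section BlockMaps

variable {V : Type*} [Fintype V] {l : ℕ}

open Classical in
/-- The maps that weakly increase along `o` and whose fibers have the sizes `μ i` and exactly one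
`o`-source each. -/
def blockMaps (o : V → V → Prop) (μ : Fin l → ℕ) : Finset (V → Fin l) :=
  Finset.univ.filter fun β => (∀ u v, o u v → β u ≤ β v) ∧
    ∀ i, (Finset.univ.filter fun v => β v = i).card = μ i ∧
      (sources o (Finset.univ.filter fun v => β v = i)).card = 1

theorem mem_blockMaps {o : V → V → Prop} {μ : Fin l → ℕ} {β : V → Fin l} :
    β ∈ blockMaps o μ ↔ (∀ u v, o u v → β u ≤ β v) ∧
      ∀ i, (Finset.univ.filter fun v => β v = i).card = μ i ∧
        (sources o (Finset.univ.filter fun v => β v = i)).card = 1 := by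
  simp [blockMaps]

end BlockMaps

/-! ### The order of the cells. -/

section Cells

variable {l N : ℕ}

theorem toLex_lt_iff_finProdFinEquiv (x y : Fin l × Fin N) :
    toLex x < toLex y ↔ finProdFinEquiv x < finProdFinEquiv y := by
  obtain ⟨a, b⟩ := x
  obtain ⟨c, d⟩ := y
  rw [Prod.Lex.toLex_lt_toLex, Fin.lt_def, Fin.lt_def, Fin.lt_def, Fin.ext_iff,
    finProdFinEquiv_apply_val, finProdFinEquiv_apply_val]
  simp only
  have hb := b.2
  have hd := d.2
  constructor
  · rintro (h | ⟨h1, h⟩)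
    · have := Nat.mul_le_mul_left N (Nat.succ_le_of_lt h)
      rw [Nat.mul_succ] at this
      omega
    · rw [h1]; omega
  · intro h
    rcases lt_trichotomy (a : ℕ) c with h1 | h1 | h1
    · exact Or.inl h1
    · rw [h1] at h
      exact Or.inr ⟨h1, by omega⟩
    · have := Nat.mul_le_mul_left N (Nat.succ_le_of_lt h1)
      rw [Nat.mul_succ] at this
      omega

/-- The numbering of the cells against the lexicographic order. -/
def cellIndex (l N : ℕ) : Fin l × Fin N ↪ ℕ :=
  ⟨fun x => (finProdFinEquiv x).rev, fun _ _ h =>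
    finProdFinEquiv.injective (Fin.rev_injective (Fin.ext h))⟩

theorem cellIndex_lt_iff (x y : Fin l × Fin N) :
    cellIndex l N x < cellIndex l N y ↔ toLex y < toLex x := by
  rw [toLex_lt_iff_finProdFinEquiv, ← Fin.rev_lt_rev, Fin.lt_def]
  rfl

end Cells

/-! ### The functional on the chromatic quasisymmetric function. -/

section Chromatic

variable {V : Type*} {l N : ℕ}

theorem isProper_cellIndex (D : Digraph V) (ψ : V → Fin l × Fin N) :
    IsProper D (cellIndex l N ∘ ψ) ↔
      ∀ u v, D.toSimpleGraphInclusive.Adj u v → toLex (ψ u) ≠ toLex (ψ v) := by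
  simp [IsProper]

variable [Fintype V]

open Classical in
-- A coloring whose monomial involves only the variables of the cells factors uniquely through `e`.
theorem coeff_embDomain_chromaticQSym (D : Digraph V) (e : Fin l × Fin N ↪ ℕ)
    (m : Fin l × Fin N →₀ ℕ) :
    coeff (embDomain e m) (chromaticQSym D) =
      ∑ ψ ∈ ((Finset.univ : Finset (V → Fin l × Fin N)).filter fun ψ => IsProper D (e ∘ ψ)).filter
        fun ψ => content (fun _ => 1) ψ = m, Polynomial.X ^ asc D (e ∘ ψ) := by
  have hcontent : ∀ ψ : V → Fin l × Fin N,
      colorExponent (e ∘ ψ) = embDomain e (content (fun _ => 1) ψ) := by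
    intro ψ
    rw [embDomain_eq_mapDomain, content, mapDomain_finsetSum, colorExponent]
    simp only [mapDomain_single, Function.comp_apply]
  change ∑ κ ∈ _, _ = _
  refine (Finset.sum_bij (fun ψ _ => e ∘ ψ) ?_ ?_ ?_ ?_).symm
  · intro ψ hψ
    simp only [Finset.mem_filter, Finset.mem_univ, true_and] at hψ
    rw [Finset.mem_filter, hcontent, hψ.2, Fintype.mem_piFinset]
    refine ⟨fun v => ?_, hψ.1, rfl⟩
    rw [mem_support_iff, Function.comp_apply, embDomain_apply_self, ← hψ.2,
      content_apply_ne_zero (fun _ => one_pos)]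
    exact ⟨v, rfl⟩
  · intro ψ _ ψ' _ h
    exact funext fun v => e.injective (congrFun h v)
  · intro κ hκ
    rw [Finset.mem_filter, Fintype.mem_piFinset] at hκ
    obtain ⟨h1, h2, h3⟩ := hκ
    have h4 : ∀ v, ∃ x, e x = κ v := by
      intro v
      by_contra hc
      exact mem_support_iff.1 (h1 v) (embDomain_of_notMem_range _ _ _ hc)
    choose ψ hψ using h4
    have h5 : e ∘ ψ = κ := funext hψ
    refine ⟨ψ, ?_, h5⟩
    simp only [Finset.mem_filter, Finset.mem_univ, true_and]
    refine ⟨h5 ▸ h2, embDomain_injective e ?_⟩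
    rw [← hcontent, h5, h3]
  · intro ψ _
    rfl

/-- Colors are numbered against the order of the cells, so an ascent along `(u, v)` means that `v`
gets the earlier cell. This turns ascents into inversions. -/
theorem asc_cellIndex (D : Digraph V) (ψ : V → Fin l × Fin N) :
    asc D (cellIndex l N ∘ ψ) =
      orientationInv D (orientation D.toSimpleGraphInclusive fun v => toLex (ψ v)) := by
  classical
  rw [orientationInv_orientation, Nat.card_eq_fintype_card, Fintype.card_subtype, asc]
  simp only [Function.comp_apply, cellIndex_lt_iff]

/-- Group the colorings by the orientation they induce, on which `asc` is constant, and apply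
`sum_prod_rowWeight` with unit weights. The fibers have the sizes `μ i`, so the sign does not depend
on `o` or `β`. -/
theorem rowFunctional_chromaticQSym (D : Digraph V) (hN : Fintype.card V ≤ N) (μ : Fin l → ℕ) :
    rowFunctional (cellIndex l N) (Fintype.card V) μ (chromaticQSym D) =
      (-1) ^ (∑ i, (μ i + 1)) *
        ∑ o ∈ acyclicOrientations D.toSimpleGraphInclusive,
          ∑ _β ∈ blockMaps o μ, Polynomial.X ^ orientationInv D o := by
  classical
  have h0 := rowFunctional_eq_sum (cellIndex l N) μ (fun _ => 1) _ _
    (coeff_embDomain_chromaticQSym D (cellIndex l N))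
  rw [Finset.sum_const, smul_eq_mul, mul_one, Finset.card_univ] at h0
  rw [h0, ← Finset.sum_fiberwise_of_maps_to
    (g := fun ψ => orientation D.toSimpleGraphInclusive fun v => toLex (ψ v))
    (t := acyclicOrientations D.toSimpleGraphInclusive), Finset.mul_sum]
  · refine Finset.sum_congr rfl fun o ho => ?_
    obtain ⟨f, -, hf⟩ := mem_acyclicOrientations.1 ho
    have h1 := sum_prod_rowWeight (o := o) (f := f) (by rw [hf]; exact fun u v h => h.2)
      (ν := fun _ => 1) (fun _ => one_pos) hN μ
    rw [Finset.filter_filter, Finset.filter_congr (q := fun ψ : V → Fin l × Fin N =>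
      ∀ u v, o u v → toLex (ψ u) < toLex (ψ v))]
    · have h2 : ∀ ψ ∈ (Finset.univ : Finset (V → Fin l × Fin N)).filter
          (fun ψ => ∀ u v, o u v → toLex (ψ u) < toLex (ψ v)),
          ((∏ i, rowWeight (μ i) (fun a => content (fun _ => 1) ψ (i, a)) : ℤ) : Polynomial ℚ) *
            Polynomial.X ^ asc D (cellIndex l N ∘ ψ) =
          ((∏ i, rowWeight (μ i) (fun a => content (fun _ => 1) ψ (i, a)) : ℤ) : Polynomial ℚ) *
            Polynomial.X ^ orientationInv D o := by
        intro ψ hψ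
        rw [Finset.mem_filter] at hψ
        rw [asc_cellIndex, ((orientation_eq_iff ho fun v => toLex (ψ v)).2 hψ.2).2]
      rw [Finset.sum_congr rfl h2, ← Finset.sum_mul, ← Int.cast_sum, h1, Finset.mul_sum,
        Int.cast_sum, Finset.sum_mul, blockMaps, Finset.sum_filter, Finset.sum_filter]
      refine Finset.sum_congr rfl fun β _ => ?_
      simp only [sourceWeight, Finset.sum_const, smul_eq_mul, mul_one]
      by_cases hs : ∀ i, (sources o (Finset.univ.filter fun v => β v = i)).card = 1
      · refine if_ctx_congr ?_ (fun hc => ?_) fun _ => rfl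
        · simp only [hs, and_true]
        · rw [Finset.prod_congr rfl fun i _ => by rw [if_pos (hs i), hs i, (hc.2 i).1,
            Nat.cast_one, mul_one], Finset.prod_pow_eq_pow_sum]
          simp
      · push Not at hs
        obtain ⟨i, hi⟩ := hs
        rw [Finset.prod_eq_zero (Finset.mem_univ i) (by rw [if_neg hi]; simp),
          Int.cast_zero, zero_mul, ite_self]
        exact (if_neg fun h => hi (h.2 i).2).symm
    · intro ψ _
      rw [isProper_cellIndex]
      exact orientation_eq_iff ho _
  · intro ψ hψ
    rw [Finset.mem_filter, isProper_cellIndex] at hψ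
    refine mem_acyclicOrientations.2 ⟨fun v => finProdFinEquiv (ψ v), fun u v huv h => ?_, ?_⟩
    · exact hψ.2 u v huv (congrArg toLex (finProdFinEquiv.injective (Fin.ext h)))
    · ext u v
      exact and_congr_right fun _ => toLex_lt_iff_finProdFinEquiv _ _

end Chromatic

/-! ### Ranks as lengths of longest paths. -/

section Rank

variable {V : Type*}

/-- The length of the longest directed path of `o` that ends in `x`. -/
def orientationRank (o : V → V → Prop) (x : V) : ℕ :=
  sSup {k | ∃ p : List V, p.length = k ∧ p.IsChain o ∧ p.getLast? = some x}

theorem length_le_card_of_isChain [Fintype V] {o : V → V → Prop} {f : V → ℕ}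
    (hf : ∀ u v, o u v → f u < f v) {p : List V} (hp : p.IsChain o) :
    p.length ≤ Fintype.card V := by
  have h1 : (p.map f).IsChain (· < ·) := (List.isChain_map f).2 (hp.imp hf)
  have h2 : (p.map f).Nodup := (List.isChain_iff_pairwise.1 h1).imp fun h => h.ne
  exact (List.Nodup.of_map f h2).length_le_card

theorem orientationRank_lt [Fintype V] {o : V → V → Prop} {f : V → ℕ}
    (hf : ∀ u v, o u v → f u < f v) {u v : V} (huv : o u v) :
    orientationRank o u < orientationRank o v := by
  -- For an unbounded set of natural numbers `sSup` is 0, so the bound from acyclicity is needed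
  -- before a longest path can be extended by `v`.
  have hbdd : ∀ x, BddAbove {k | ∃ p : List V, p.length = k ∧ p.IsChain o ∧
      p.getLast? = some x} := by
    rintro x
    refine ⟨Fintype.card V, ?_⟩
    rintro k ⟨p, rfl, hp, -⟩
    exact length_le_card_of_isChain hf hp
  obtain ⟨p, hlen, hp, hlast⟩ := Nat.sSup_mem (s := {k | ∃ p : List V, p.length = k ∧
    p.IsChain o ∧ p.getLast? = some u}) ⟨1, [u], rfl, List.isChain_singleton _, rfl⟩ (hbdd u)
  refine Nat.lt_of_succ_le (le_csSup (hbdd v) ⟨p ++ [v], ?_, ?_, ?_⟩)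
  · rw [List.length_append, hlen]; rfl
  · refine List.isChain_append.2 ⟨hp, List.isChain_singleton _, ?_⟩
    intro x hx y hy
    rw [hlast] at hx
    simp only [Option.mem_def, Option.some.injEq, List.head?_cons] at hx hy
    rw [← hx, ← hy]
    exact huv
  · simp

/-- The rank depends on `σ` only through the induced orientation, which is what makes `σ`
recoverable from the orientation and the blocks. -/
theorem graphRank_eq {n : ℕ} (G : SimpleGraph (Fin n)) (σ : Equiv.Perm (Fin n)) (x : Fin n) :
    graphRank G σ x = orientationRank (orientation G σ.symm) x := by
  rw [graphRank, orientationRank]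
  congr 1
  ext k
  constructor
  · rintro ⟨p, hlen, hp, hlast⟩
    refine ⟨p.map σ, by simpa using hlen, ?_, by simp [hlast]⟩
    refine (List.isChain_map σ).2 (hp.imp fun i j h => ⟨h.2, ?_⟩)
    simpa using h.1
  · rintro ⟨p, hlen, hp, hlast⟩
    refine ⟨p.map σ.symm, by simpa using hlen, ?_, by simp [hlast]⟩
    refine (List.isChain_map σ.symm).2 (hp.imp fun i j h => ⟨h.2, ?_⟩)
    simpa using h.1

end Rank

/-! ### Sorting by block, rank and label. -/

section Sorting

variable {n l : ℕ}

/-- The key by which the vertices are sorted: block, rank, label. -/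
def sortKey (o : Fin n → Fin n → Prop) (β : Fin n → Fin l) (v : Fin n) :
    Fin l ×ₗ (ℕ ×ₗ Fin n) :=
  toLex (β v, toLex (orientationRank o v, v))

theorem sortKey_injective (o : Fin n → Fin n → Prop) (β : Fin n → Fin l) :
    Function.Injective (sortKey o β) := by
  intro u v h
  have h1 := congrArg (fun k => (ofLex (ofLex k).2).2) h
  exact h1

theorem sortKey_lt_iff {o : Fin n → Fin n → Prop} {β : Fin n → Fin l} {u v : Fin n} :
    sortKey o β u < sortKey o β v ↔ β u < β v ∨ β u = β v ∧
      (orientationRank o u < orientationRank o v ∨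
        orientationRank o u = orientationRank o v ∧ u < v) := by
  rw [sortKey, sortKey, Prod.Lex.toLex_lt_toLex, Prod.Lex.toLex_lt_toLex]

theorem strictMono_of_lt_next {α : Type*} [Preorder α] {f : Fin n → α}
    (h : ∀ i j : Fin n, (j : ℕ) = i + 1 → f i < f j) : StrictMono f := by
  cases n with
  | zero => exact fun i => i.elim0
  | succ n => exact Fin.strictMono_iff_lt_succ.2 fun i => h _ _ (by simp)

/-- If `a j < b j`, every `x` with `b x ≤ a j` precedes `j` and so has `a x ≤ a j`. But `j` itself
satisfies only the latter bound, so the two counts differ. -/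
theorem le_of_card_fiber_eq {a b : Fin n → Fin l} (ha : Monotone a) (hb : Monotone b)
    (h : ∀ i, (Finset.univ.filter fun x => a x = i).card =
      (Finset.univ.filter fun x => b x = i).card) (j : Fin n) : b j ≤ a j := by
  by_contra! hlt
  have hcard : ∀ c : Fin n → Fin l, (Finset.univ.filter fun x => c x ≤ a j).card =
      ∑ i ∈ Finset.univ.filter (fun i => i ≤ a j), (Finset.univ.filter fun x => c x = i).card := by
    intro c
    rw [Finset.card_eq_sum_card_fiberwise (f := c)
      (t := Finset.univ.filter fun i => i ≤ a j) (fun x hx => by simpa using hx)]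
    refine Finset.sum_congr rfl fun i hi => ?_
    rw [Finset.filter_filter]
    congr 1
    refine Finset.filter_congr fun x _ => ?_
    simp only [Finset.mem_filter, Finset.mem_univ, true_and] at hi
    exact ⟨fun h => h.2, fun h => ⟨h ▸ hi, h⟩⟩
  have h1 : (Finset.univ.filter fun x => a x ≤ a j).card =
      (Finset.univ.filter fun x => b x ≤ a j).card := by
    rw [hcard, hcard]
    exact Finset.sum_congr rfl fun i _ => h i
  have h2 : (Finset.univ.filter fun x => b x ≤ a j) ⊂ Finset.univ.filter fun x => a x ≤ a j := by
    rw [Finset.ssubset_iff_of_subset]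
    · exact ⟨j, by simp, by simpa using hlt⟩
    · intro x hx
      simp only [Finset.mem_filter, Finset.mem_univ, true_and] at hx ⊢
      refine ha (le_of_lt ?_)
      by_contra! hc
      exact absurd (hb hc) (not_le.2 (hx.trans_lt hlt))
  exact (Finset.card_lt_card h2).ne' h1

theorem eq_of_monotone_of_card_fiber_eq {a b : Fin n → Fin l} (ha : Monotone a) (hb : Monotone b)
    (h : ∀ i, (Finset.univ.filter fun x => a x = i).card =
      (Finset.univ.filter fun x => b x = i).card) : a = b :=
  funext fun j => le_antisymm (le_of_card_fiber_eq hb ha (fun i => (h i).symm) j)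
    (le_of_card_fiber_eq ha hb h j)

end Sorting

/-! ### Permutations in `N_μ(G)` as orientations with blocks. -/

section Blocks

variable {n : ℕ} (c : Composition n)

theorem index_eq_iff {j : Fin n} {i : Fin c.length} :
    c.index j = i ↔ c.sizeUpTo i ≤ j ∧ (j : ℕ) < c.sizeUpTo (i + 1) := by
  rw [eq_comm, ← c.mem_range_embedding_iff', c.mem_range_embedding_iff]

theorem index_monotone : Monotone c.index := by
  intro j k hjk
  by_contra! h
  have h1 := c.sizeUpTo_index_le j
  have h2 := c.lt_sizeUpTo_index_succ k
  have h3 : c.sizeUpTo (c.index k).succ ≤ c.sizeUpTo (c.index j) :=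
    c.monotone_sizeUpTo (Nat.succ_le_of_lt h)
  have : (j : ℕ) ≤ k := hjk
  omega

theorem card_index_fiber (i : Fin c.length) :
    (Finset.univ.filter fun j => c.index j = i).card = c.blocksFun i := by
  have : (Finset.univ.filter fun j => c.index j = i) =
      Finset.univ.map (c.embedding i).toEmbedding := by
    ext j
    simp only [Finset.mem_filter, Finset.mem_univ, true_and, Finset.mem_map]
    rw [eq_comm, ← c.mem_range_embedding_iff']
    rfl
  rw [this, Finset.card_map, Finset.card_fin]

theorem card_index_symm_fiber (σ : Equiv.Perm (Fin n)) (i : Fin c.length) :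
    (Finset.univ.filter fun v => c.index (σ.symm v) = i).card = c.blocksFun i := by
  rw [← card_index_fiber]
  refine Finset.card_equiv σ.symm fun v => ?_
  simp

theorem mem_sources_block (G : SimpleGraph (Fin n)) (σ : Equiv.Perm (Fin n)) (j : Fin n)
    (i : Fin c.length) :
    σ j ∈ sources (orientation G σ.symm) (Finset.univ.filter fun v => c.index (σ.symm v) = i) ↔
      c.index j = i ∧ ∀ k : Fin n, c.sizeUpTo i ≤ k → k < j → ¬ G.Adj (σ k) (σ j) := by
  rw [mem_sources]
  simp only [Finset.mem_filter, Finset.mem_univ, true_and, Equiv.symm_apply_apply, orientation,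
    not_and]
  refine and_congr_right fun hj => ⟨fun h k hk hkj hadj => ?_, fun h v hv hadj hlt => ?_⟩
  · refine h (σ k) ?_ hadj (by simpa using hkj)
    rw [Equiv.symm_apply_apply, index_eq_iff]
    have := (index_eq_iff c).1 hj
    have : (k : ℕ) < j := hkj
    omega
  · refine h (σ.symm v) ((index_eq_iff c).1 hv).1 hlt (by simpa using hadj)

/-- The first letter of a block is always a source, and the other sources are exactly its isolated
letters. -/
theorem card_sources_block_eq_one_iff (G : SimpleGraph (Fin n)) (σ : Equiv.Perm (Fin n))
    (i : Fin c.length) :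
    (sources (orientation G σ.symm)
        (Finset.univ.filter fun v => c.index (σ.symm v) = i)).card = 1 ↔
      ∀ j : Fin n, c.index j = i → ¬ IsGIsolated G σ (c.sizeUpTo i) j := by
  have hlt := c.sizeUpTo_strict_mono i.2
  have hle := c.sizeUpTo_le (i + 1)
  let s : Fin n := ⟨c.sizeUpTo i, by omega⟩
  have hs : c.index s = i := (index_eq_iff c).2 ⟨le_rfl, hlt⟩
  have hsrc : σ s ∈ sources (orientation G σ.symm)
      (Finset.univ.filter fun v => c.index (σ.symm v) = i) := by
    refine (mem_sources_block c G σ s i).2 ⟨hs, fun k hk hks => ?_⟩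
    have : (k : ℕ) < c.sizeUpTo i := hks
    omega
  constructor
  · rintro h j hj ⟨h1, h2⟩
    have h3 := (mem_sources_block c G σ j i).2 ⟨hj, h2⟩
    have h4 := σ.injective (Finset.card_le_one.1 h.le _ h3 _ hsrc)
    rw [h4] at h1
    exact lt_irrefl _ h1
  · intro h
    rw [Finset.card_eq_one]
    refine ⟨σ s, Finset.eq_singleton_iff_unique_mem.2 ⟨hsrc, fun v hv => ?_⟩⟩
    obtain ⟨j, rfl⟩ := σ.surjective v
    obtain ⟨hj, h2⟩ := (mem_sources_block c G σ j i).1 hv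
    have h3 := h j hj
    have h4 := ((index_eq_iff c).1 hj).1
    have h5 : ¬ c.sizeUpTo i < j := fun h5 => h3 ⟨h5, h2⟩
    congr 1
    exact Fin.ext (by simp only [s]; omega)

/-- Block indices weakly increase along the word, so the keys can fail to increase only at
consecutive positions of one block, and there failure is a `G`-descent. -/
theorem mem_NSet_iff (μ : n.Partition) (G : SimpleGraph (Fin n)) (σ : Equiv.Perm (Fin n)) :
    σ ∈ NSet μ G ↔
      (∀ i, (sources (orientation G σ.symm) (Finset.univ.filter
          fun v => (sortedComposition μ).index (σ.symm v) = i)).card = 1) ∧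
        StrictMono fun j => sortKey (orientation G σ.symm)
          (fun v => (sortedComposition μ).index (σ.symm v)) (σ j) := by
  classical
  set c := sortedComposition μ with hc
  have hlen : μ.parts.card = c.length := (Multiset.length_sort _).symm
  have hps : ∀ i, partialSum μ i = c.sizeUpTo i := fun _ => rfl
  have h1 : σ ∈ NSet μ G ↔ (∀ i : Fin c.length,
      (∀ j : Fin n, c.index j = i → ¬ IsGIsolated G σ (c.sizeUpTo i) j)) ∧
      ∀ i : Fin c.length, ∀ j : Fin n, c.sizeUpTo i ≤ j → (j : ℕ) + 1 < c.sizeUpTo (i + 1) →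
        ¬ IsGDescent G σ j := by
    rw [NSet, Finset.mem_filter, hlen]
    simp only [Finset.mem_univ, true_and, hps, index_eq_iff]
    constructor
    · intro h
      exact ⟨fun i j hj => (h i i.2).1 j hj.1 hj.2, fun i => (h i i.2).2⟩
    · intro h i hi
      exact ⟨fun j h1 h2 => h.1 ⟨i, hi⟩ j ⟨h1, h2⟩, h.2 ⟨i, hi⟩⟩
  rw [h1]
  refine and_congr (forall_congr' fun i => (card_sources_block_eq_one_iff c G σ i).symm) ?_
  constructor
  · intro h
    refine strictMono_of_lt_next fun j k hjk => sortKey_lt_iff.2 ?_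
    simp only [Equiv.symm_apply_apply]
    have hjk' : j < k := Fin.lt_def.2 (by omega)
    rcases (index_monotone c hjk'.le).lt_or_eq with hlt | heq
    · exact Or.inl hlt
    · refine Or.inr ⟨heq, ?_⟩
      have h2 := (index_eq_iff c).1 heq
      have h3 := c.lt_sizeUpTo_index_succ k
      rw [Fin.val_succ] at h3
      have h4 := h (c.index k) j h2.1 (by omega)
      have hne : σ j ≠ σ k := fun h => hjk'.ne (σ.injective h)
      by_contra hcon
      push Not at hcon
      refine h4 ⟨k, hjk, ?_⟩
      rw [graphRank_eq, graphRank_eq]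
      rcases hcon.1.lt_or_eq with h5 | h5
      · exact Or.inl h5
      · exact Or.inr ⟨h5.symm, lt_of_le_of_ne (hcon.2 h5.symm) hne.symm⟩
  · rintro h i j hj1 hj2 ⟨k, hk, hdes⟩
    have h2 := sortKey_lt_iff.1 (h (show j < k from Fin.lt_def.2 (by omega)))
    simp only [Equiv.symm_apply_apply] at h2
    have hj : c.index j = i := (index_eq_iff c).2 ⟨hj1, by omega⟩
    have hk' : c.index k = i := (index_eq_iff c).2 ⟨by omega, by omega⟩
    rw [hj, hk'] at h2
    rw [graphRank_eq, graphRank_eq] at hdes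
    rcases h2 with h2 | ⟨-, h2 | ⟨h2, h3⟩⟩
    · exact lt_irrefl _ h2
    · rcases hdes with h4 | h4 <;> omega
    · rcases hdes with h4 | ⟨-, h4⟩
      · omega
      · exact h3.asymm h4

/-- A bijection: `σ` lists the vertices by increasing key, and the key is determined by the
orientation and the block map. -/
theorem sum_NSet (D : Digraph (Fin n)) (μ : n.Partition) :
    ∑ σ ∈ NSet μ D.toSimpleGraphInclusive, (Polynomial.X : Polynomial ℚ) ^ digraphInv D σ =
      ∑ o ∈ acyclicOrientations D.toSimpleGraphInclusive,
        ∑ _β ∈ blockMaps o (sortedComposition μ).blocksFun, Polynomial.X ^ orientationInv D o := by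
  classical
  set c := sortedComposition μ with hc
  set G := D.toSimpleGraphInclusive with hG
  rw [Finset.sum_sigma']
  refine Finset.sum_bij
    (fun σ _ => ⟨orientation G σ.symm, fun v => c.index (σ.symm v)⟩) ?_ ?_ ?_ ?_
  · intro σ hσ
    rw [mem_NSet_iff] at hσ
    refine Finset.mem_sigma.2 ⟨mem_acyclicOrientations.2 ⟨fun v => σ.symm v, ?_, rfl⟩,
      mem_blockMaps.2 ⟨fun u v huv => index_monotone c huv.2.le, fun i =>
        ⟨card_index_symm_fiber c σ i, hσ.1 i⟩⟩⟩
    intro u v huv h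
    exact huv.ne (σ.symm.injective (Fin.ext h))
  · intro σ hσ τ hτ h
    rw [mem_NSet_iff] at hσ hτ
    rw [Sigma.mk.injEq] at h
    have h1 := h.1
    have h2 := eq_of_heq h.2
    have h3 := hσ.2
    rw [h1, h2] at h3
    -- Two strictly increasing maps on `Fin n` with the same range coincide.
    have h4 := (h3.range_inj hτ.2).1 (by
      rw [Set.range_comp' _ σ, Set.range_comp' _ τ, σ.range_eq_univ, τ.range_eq_univ])
    exact Equiv.ext fun j => sortKey_injective _ _ (congrFun h4 j)
  · rintro ⟨o, β⟩ hoβ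
    obtain ⟨ho, hβ⟩ := Finset.mem_sigma.1 hoβ
    dsimp only at ho hβ
    obtain ⟨hmono, hfib⟩ := mem_blockMaps.1 hβ
    obtain ⟨f, -, hf⟩ := mem_acyclicOrientations.1 ho
    have hf' : ∀ u v, o u v → f u < f v := by rw [hf]; exact fun u v h => h.2
    let σ := Tuple.sort (sortKey o β)
    have hσ : StrictMono (sortKey o β ∘ σ) :=
      (Tuple.monotone_sort (sortKey o β)).strictMono_of_injective
        ((sortKey_injective o β).comp σ.injective)
    -- Along an edge of `o` the block weakly increases and, within a block, the rank strictly
    -- increases, so the sorted word respects `o`.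
    have h1 : orientation G σ.symm = o := by
      refine ((orientation_eq_iff ho σ.symm).2 fun u v huv => ?_).2
      rw [← hσ.lt_iff_lt]
      simp only [Function.comp_apply, Equiv.apply_symm_apply]
      rw [sortKey_lt_iff]
      rcases (hmono u v huv).lt_or_eq with h | h
      · exact Or.inl h
      · exact Or.inr ⟨h, Or.inl (orientationRank_lt hf' huv)⟩
    have hmono' : Monotone (β ∘ σ) := by
      intro j k hjk
      rcases hjk.lt_or_eq with h | rfl
      · rcases sortKey_lt_iff.1 (hσ h) with h | h
        · exact h.le
        · exact h.1.le
      · exact le_rfl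
    have h2 : c.index = β ∘ σ := by
      refine eq_of_monotone_of_card_fiber_eq (index_monotone c) hmono' fun i => ?_
      rw [card_index_fiber, ← (hfib i).1]
      refine Finset.card_equiv σ.symm fun v => ?_
      simp
    have h3 : (fun v => c.index (σ.symm v)) = β := by
      ext v
      simp [h2]
    refine ⟨σ, ?_, by rw [h1, h3]⟩
    rw [mem_NSet_iff, ← hc, h1]
    refine ⟨fun i => ?_, ?_⟩
    · have := (hfib i).2
      rwa [← h3] at this
    · rw [h3]
      exact hσ
  · intro σ _
    rw [orientationInv_orientation, Nat.card_eq_fintype_card, Fintype.card_subtype, digraphInv]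

end Blocks

/-! ### Newton's identities and the action of `ω` on power sums. -/

section Newton

variable {R : Type*} [CommRing R]

theorem coeff_psum_mul {k : ℕ} (hk : k ≠ 0) (g : MvPowerSeries ℕ R) (m : ℕ →₀ ℕ) :
    coeff m ((psum R k : MvPowerSeries ℕ R) * g) =
      ∑ i ∈ m.support.filter (fun i => k ≤ m i), coeff (m - single i k) g := by
  classical
  rw [coeff_mul]
  have h1 : ∀ q : (ℕ →₀ ℕ) × (ℕ →₀ ℕ), coeff q.1 (psum R k : MvPowerSeries ℕ R) * coeff q.2 g =
      if ∃ i, q.1 = single i k then coeff q.2 g else 0 := by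
    intro q
    change (if ∃ i, q.1 = single i k then (1 : R) else 0) * _ = _
    split_ifs <;> simp
  simp only [h1]
  rw [← Finset.sum_filter]
  refine (Finset.sum_bij (fun i _ => (single i k, m - single i k)) ?_ ?_ ?_ ?_).symm
  · intro i hi
    simp only [Finset.mem_filter, Finset.HasAntidiagonal.mem_antidiagonal] at hi ⊢
    exact ⟨add_tsub_cancel_of_le (single_le_iff.2 hi.2), i, rfl⟩
  · intro i _ j _ h
    exact single_left_injective hk (Prod.ext_iff.1 h).1
  · rintro ⟨q, r⟩ hq
    simp only [Finset.mem_filter, Finset.HasAntidiagonal.mem_antidiagonal] at hq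
    obtain ⟨rfl, i, rfl⟩ := hq
    refine ⟨i, ?_, by simp⟩
    have h : k ≤ (single i k + r) i := by
      rw [Finsupp.add_apply, single_eq_same]; omega
    exact Finset.mem_filter.2 ⟨mem_support_iff.2 (by omega), h⟩
  · intro i _
    rfl

/-- Newton's identity for the complete homogeneous symmetric functions. -/
theorem succ_mul_hsymm (k : ℕ) :
    ((k + 1 : ℕ) : SymFunc R) * hsymm R (k + 1) =
      ∑ p ∈ Finset.HasAntidiagonal.antidiagonal k, psum R (p.1 + 1) * hsymm R p.2 := by
  classical
  apply Subtype.ext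
  ext m
  rw [← Subalgebra.val_apply, ← Subalgebra.val_apply, map_sum, map_sum, map_mul, map_natCast]
  simp only [map_mul, Subalgebra.val_apply, coeff_psum_mul (Nat.add_one_ne_zero _), coeff_hsymm]
  rw [← nsmul_eq_mul, map_nsmul, coeff_hsymm]
  by_cases hm : m.degree = k + 1
  · rw [if_pos hm]
    have h1 : ∀ p ∈ Finset.HasAntidiagonal.antidiagonal k,
        (∑ i ∈ m.support.filter (fun i => p.1 + 1 ≤ m i),
          if (m - single i (p.1 + 1)).degree = p.2 then (1 : R) else 0) =
        ∑ i ∈ m.support, if p.1 < m i then 1 else 0 := by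
      intro p hp
      rw [Finset.HasAntidiagonal.mem_antidiagonal] at hp
      rw [Finset.sum_filter]
      refine Finset.sum_congr rfl fun i _ => ?_
      by_cases hi : p.1 + 1 ≤ m i
      · rw [if_pos hi, if_pos (Nat.lt_of_succ_le hi), if_pos]
        have h2 : (m - single i (p.1 + 1)).degree + (single i (p.1 + 1)).degree = m.degree := by
          rw [← map_add, tsub_add_cancel_of_le (single_le_iff.2 hi)]
        rw [degree_single] at h2
        omega
      · rw [if_neg hi, if_neg (by omega)]
    -- Each variable `i` of a monomial of degree `k + 1` now contributes its exponent `m i`, and the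
    -- exponents add up to `k + 1`.
    rw [Finset.sum_congr rfl h1, Finset.sum_comm]
    have h2 : ∀ i ∈ m.support, (∑ p ∈ Finset.HasAntidiagonal.antidiagonal k,
        if p.1 < m i then (1 : R) else 0) = m i := by
      intro i hi
      have h3 : m i ≤ k + 1 := by
        rw [← hm, Finsupp.degree_apply]
        exact Finset.single_le_sum (f := fun i => m i) (fun _ _ => Nat.zero_le _) hi
      rw [Finset.Nat.sum_antidiagonal_eq_sum_range_succ_mk]
      simp only
      rw [Finset.sum_boole]
      congr 1
      have : (Finset.range k.succ).filter (fun a => a < m i) = Finset.range (m i) := by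
        ext a
        simp only [Finset.mem_filter, Finset.mem_range]
        omega
      rw [this, Finset.card_range]
    rw [Finset.sum_congr rfl h2, ← Nat.cast_sum, ← Finsupp.degree_apply, hm, nsmul_eq_mul, mul_one]
  · rw [if_neg hm, smul_zero]
    refine (Finset.sum_eq_zero fun p hp => Finset.sum_eq_zero fun i hi => if_neg fun h => hm ?_).symm
    rw [Finset.HasAntidiagonal.mem_antidiagonal] at hp
    rw [Finset.mem_filter] at hi
    have h2 : (m - single i (p.1 + 1)).degree + (single i (p.1 + 1)).degree = m.degree := by
      rw [← map_add, tsub_add_cancel_of_le (single_le_iff.2 hi.2)]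
    rw [degree_single] at h2
    omega

variable (R) in
/-- The generating function of the elementary symmetric functions. -/
def esymmSeries : PowerSeries (SymFunc R) := PowerSeries.mk (esymm R)

variable (R) in
/-- The generating function of the complete homogeneous symmetric functions. -/
def hsymmSeries : PowerSeries (SymFunc R) := PowerSeries.mk (hsymm R)

variable (R) in
/-- The generating function of the power sum symmetric functions, with `p_{k+1}` in degree `k`. -/
def psumSeries : PowerSeries (SymFunc R) := PowerSeries.mk fun k => psum R (k + 1)

theorem rescale_esymmSeries_mul_hsymmSeries :
    PowerSeries.rescale (-1) (esymmSeries R) * hsymmSeries R = 1 := by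
  ext1 k
  rw [PowerSeries.coeff_mul, PowerSeries.coeff_one]
  simp only [PowerSeries.coeff_rescale, esymmSeries, hsymmSeries, PowerSeries.coeff_mk]
  split_ifs with hk
  · subst hk
    simp [esymm_zero, hsymm_zero]
  · rw [← sum_esymm_mul_hsymm (R := R) hk]
    exact Finset.sum_congr rfl fun p _ => by ring

theorem derivative_hsymmSeries :
    PowerSeries.derivative (SymFunc R) (hsymmSeries R) = psumSeries R * hsymmSeries R := by
  ext1 k
  rw [PowerSeries.coeff_derivative, PowerSeries.coeff_mul]
  simp only [psumSeries, hsymmSeries, PowerSeries.coeff_mk]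
  rw [← succ_mul_hsymm]
  push_cast
  ring

theorem derivative_rescale_neg_one {A : Type*} [CommRing A] (F : PowerSeries A) :
    PowerSeries.derivative A (PowerSeries.rescale (-1) F) =
      -PowerSeries.rescale (-1) (PowerSeries.derivative A F) := by
  ext1 k
  simp only [PowerSeries.coeff_derivative, PowerSeries.coeff_rescale, map_neg]
  ring

theorem rescale_neg_one_rescale_neg_one {A : Type*} [CommRing A] (F : PowerSeries A) :
    PowerSeries.rescale (-1) (PowerSeries.rescale (-1) F) = F := by
  rw [PowerSeries.rescale_rescale, neg_one_mul, neg_neg, PowerSeries.rescale_one, RingHom.id_apply]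

/-- Newton's identity for the elementary symmetric functions. -/
theorem derivative_esymmSeries :
    PowerSeries.derivative (SymFunc R) (esymmSeries R) =
      PowerSeries.rescale (-1) (psumSeries R) * esymmSeries R := by
  have h1 := rescale_esymmSeries_mul_hsymmSeries (R := R)
  have h2 := congrArg (PowerSeries.derivative (SymFunc R)) h1
  rw [Derivation.leibniz, derivative_hsymmSeries, derivative_rescale_neg_one,
    Derivation.map_one_eq_zero, smul_eq_mul, smul_eq_mul] at h2
  have h3 : PowerSeries.rescale (-1) (PowerSeries.derivative (SymFunc R) (esymmSeries R)) =
      psumSeries R * PowerSeries.rescale (-1) (esymmSeries R) := by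
    -- Multiplying the differentiated identity by `E(-z)` cancels `H(z)`.
    linear_combination (-PowerSeries.rescale (-1) (esymmSeries R)) * h2 +
      (psumSeries R * PowerSeries.rescale (-1) (esymmSeries R) -
        PowerSeries.rescale (-1) (PowerSeries.derivative (SymFunc R) (esymmSeries R))) * h1
  rw [← rescale_neg_one_rescale_neg_one (PowerSeries.derivative _ _), h3, map_mul,
    rescale_neg_one_rescale_neg_one]

/-- Applying `ω` to `H' = P H` gives `E' = ω(P) E`, while Newton's identity reads `E' = P(-z) E`. As
`E` is invertible, `ω(P) = P(-z)`. -/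
theorem omegaInvolution_psum_succ (k : ℕ) :
    omegaInvolution R (psum R (k + 1)) = (-1) ^ k * psum R (k + 1) := by
  let w : SymFunc R →+* SymFunc R := (omegaInvolution R : SymFunc R →+* SymFunc R)
  have hH : PowerSeries.map w (hsymmSeries R) = esymmSeries R := by
    ext1 k
    rw [PowerSeries.coeff_map, hsymmSeries, esymmSeries, PowerSeries.coeff_mk,
      PowerSeries.coeff_mk]
    exact omegaInvolution_hsymm k
  have h1 : PowerSeries.derivative (SymFunc R) (esymmSeries R) =
      PowerSeries.map w (psumSeries R) * esymmSeries R := by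
    have h2 := congrArg (PowerSeries.map w) (derivative_hsymmSeries (R := R))
    rw [map_mul, hH] at h2
    rw [← h2, ← hH]
    ext1 k
    simp [PowerSeries.coeff_derivative, PowerSeries.coeff_map]
  rw [derivative_esymmSeries] at h1
  have h3 := congrArg (PowerSeries.rescale (-1)) (rescale_esymmSeries_mul_hsymmSeries (R := R))
  rw [map_mul, rescale_neg_one_rescale_neg_one, map_one] at h3
  have h4 : PowerSeries.map w (psumSeries R) = PowerSeries.rescale (-1) (psumSeries R) := by
    linear_combination (-PowerSeries.rescale (-1) (hsymmSeries R)) * h1 +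
      (PowerSeries.rescale (-1) (psumSeries R) - PowerSeries.map w (psumSeries R)) * h3
  have h5 := congrArg (PowerSeries.coeff k) h4
  rw [PowerSeries.coeff_map, PowerSeries.coeff_rescale, psumSeries, PowerSeries.coeff_mk] at h5
  exact h5

theorem omegaInvolution_psum {k : ℕ} (hk : 0 < k) :
    omegaInvolution R (psum R k) = (-1) ^ (k + 1) * psum R k := by
  obtain ⟨k, rfl⟩ : ∃ j, k = j + 1 := ⟨k - 1, by omega⟩
  rw [omegaInvolution_psum_succ, pow_succ, pow_succ]
  ring

theorem omegaInvolution_psumPart {n : ℕ} (μ : n.Partition) :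
    omegaInvolution R (psumPart R μ) =
      (-1) ^ (∑ i, ((sortedComposition μ).blocksFun i + 1)) * psumPart R μ := by
  rw [psumPart_eq_prod, map_prod, ← Finset.prod_pow_eq_pow_sum, ← Finset.prod_mul_distrib]
  exact Finset.prod_congr rfl fun i _ =>
    omegaInvolution_psum ((sortedComposition μ).one_le_blocksFun i)

end Newton

/-! ### Power sums span the symmetric functions over a `ℚ`-algebra. -/

section Span

variable {R : Type*} [CommRing R]

/-- Homogeneity of a power series. -/
def IsHomog (n : ℕ) (f : MvPowerSeries ℕ R) : Prop := ∀ m : ℕ →₀ ℕ, m.degree ≠ n → coeff m f = 0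

theorem IsHomog.mul {a b : ℕ} {f g : MvPowerSeries ℕ R} (hf : IsHomog a f) (hg : IsHomog b g) :
    IsHomog (a + b) (f * g) := by
  classical
  intro m hm
  rw [coeff_mul]
  refine Finset.sum_eq_zero fun p hp => ?_
  rw [Finset.HasAntidiagonal.mem_antidiagonal] at hp
  have hdeg : p.1.degree + p.2.degree = m.degree := by rw [← hp, map_add]
  by_cases h : p.1.degree = a
  · rw [hg _ (by omega), mul_zero]
  · rw [hf _ h, zero_mul]

theorem isHomog_psum (k : ℕ) : IsHomog k (psum R k : MvPowerSeries ℕ R) := by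
  rintro m hm
  refine if_neg ?_
  rintro ⟨i, rfl⟩
  simp at hm

theorem isHomog_multiset_prod_psum (t : Multiset ℕ) :
    IsHomog t.sum ((t.map (psum R)).prod : MvPowerSeries ℕ R) := by
  induction t using Multiset.induction_on with
  | empty =>
    classical
    intro m hm
    rw [Multiset.map_zero, Multiset.prod_zero, OneMemClass.coe_one, coeff_one, if_neg]
    rintro rfl
    simp at hm
  | cons a t ih =>
    rw [Multiset.map_cons, Multiset.prod_cons, Multiset.sum_cons, Subalgebra.coe_mul]
    exact (isHomog_psum a).mul ih

/-- Newton's identity is solved recursively for `e_{k+1}`; dividing by `k + 1` uses the rational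
scalars. -/
theorem esymm_mem_adjoin_psum [Algebra ℚ R] (k : ℕ) :
    esymm R k ∈ Algebra.adjoin R (Set.range fun k => psum R (k + 1)) := by
  induction k using Nat.strong_induction_on with
  | _ k ih =>
    rcases k with _ | k
    · rw [esymm_zero]; exact one_mem _
    have h1 := congrArg (PowerSeries.coeff k) (derivative_esymmSeries (R := R))
    rw [PowerSeries.coeff_derivative, PowerSeries.coeff_mul] at h1
    simp only [esymmSeries, psumSeries, PowerSeries.coeff_rescale, PowerSeries.coeff_mk] at h1
    have h2 : esymm R (k + 1) * (k + 1) ∈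
        Algebra.adjoin R (Set.range fun k => psum R (k + 1)) := by
      rw [h1]
      refine sum_mem fun p hp => mul_mem (mul_mem (pow_mem (neg_mem (one_mem _)) _)
        (Algebra.subset_adjoin ⟨p.1, rfl⟩)) (ih _ ?_)
      rw [Finset.HasAntidiagonal.mem_antidiagonal] at hp
      omega
    have h3 : esymm R (k + 1) =
        algebraMap ℚ R ((k + 1 : ℚ)⁻¹) • (esymm R (k + 1) * (k + 1)) := by
      have h4 : algebraMap ℚ R ((k + 1 : ℚ)⁻¹) * (k + 1) = 1 := by
        have : ((k : R) + 1) = algebraMap ℚ R (k + 1) := by simp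
        rw [this, ← map_mul, inv_mul_cancel₀ (by positivity), map_one]
      rw [Algebra.smul_def]
      have h5 := congrArg (algebraMap R (SymFunc R)) h4
      rw [map_mul, map_add, map_natCast, map_one] at h5
      linear_combination (-esymm R (k + 1)) * h5
    rw [h3]
    exact Subalgebra.smul_mem _ h2 _

theorem adjoin_psum_eq_top [Algebra ℚ R] :
    Algebra.adjoin R (Set.range fun k => psum R (k + 1)) = ⊤ := by
  rw [eq_top_iff]
  rintro f -
  obtain ⟨P, rfl⟩ := ofEsymm_surjective f
  induction P using MvPolynomial.induction_on with
  | C r =>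
    rw [← MvPolynomial.algebraMap_eq, AlgHom.commutes]
    exact Subalgebra.algebraMap_mem _ r
  | add p q hp hq => rw [map_add]; exact add_mem hp hq
  | mul_X p i hp =>
    rw [map_mul]
    refine mul_mem hp ?_
    rw [ofEsymm, MvPolynomial.aeval_X]
    exact esymm_mem_adjoin_psum _

/-- Comparing only coefficients in degree `n` makes the claim linear in `f`. It can then be checked
on all products of power sums, where those of another degree contribute 0. -/
theorem exists_coeff_eq_sum_psumPart [Algebra ℚ R] (f : SymFunc R) (n : ℕ) :
    ∃ a : n.Partition → R, ∀ m : ℕ →₀ ℕ, m.degree = n →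
      coeff m (f : MvPowerSeries ℕ R) =
        coeff m ((∑ μ, a μ • psumPart R μ : SymFunc R) : MvPowerSeries ℕ R) := by
  have hf : f ∈ Submodule.span R
      (Submonoid.closure (Set.range fun k => psum R (k + 1)) : Set (SymFunc R)) := by
    rw [← Algebra.adjoin_eq_span, adjoin_psum_eq_top]
    trivial
  induction hf using Submodule.span_induction with
  | mem x hx =>
    obtain ⟨s, hs, rfl⟩ := Submonoid.exists_multiset_of_mem_closure hx
    obtain ⟨t, ht, rfl⟩ : ∃ t : Multiset ℕ, (∀ k ∈ t, 0 < k) ∧ s = t.map (psum R) := by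
      clear hx
      induction s using Multiset.induction_on with
      | empty => exact ⟨0, by simp, rfl⟩
      | cons a s ih =>
        obtain ⟨t, ht, rfl⟩ := ih fun y hy => hs y (Multiset.mem_cons_of_mem hy)
        obtain ⟨k, rfl⟩ := hs a (Multiset.mem_cons_self _ _)
        refine ⟨(k + 1) ::ₘ t, fun j hj => ?_, by rw [Multiset.map_cons]⟩
        rcases Multiset.mem_cons.1 hj with rfl | hj
        · omega
        · exact ht j hj
    classical
    by_cases hn : t.sum = n
    · refine ⟨Pi.single ⟨t, fun {i} hi => ht i hi, hn⟩ 1, fun m _ => ?_⟩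
      rw [Finset.sum_eq_single (⟨t, fun {i} hi => ht i hi, hn⟩ : n.Partition), Pi.single_eq_same,
        one_smul]
      · rfl
      · intro ρ _ hρ
        rw [Pi.single_eq_of_ne hρ, zero_smul]
      · simp
    · refine ⟨0, fun m hm => ?_⟩
      rw [isHomog_multiset_prod_psum t m (by omega)]
      simp
  | zero => exact ⟨0, fun m _ => by simp⟩
  | add x y _ _ hx hy =>
    obtain ⟨a, ha⟩ := hx
    obtain ⟨b, hb⟩ := hy
    refine ⟨a + b, fun m hm => ?_⟩
    simp only [Pi.add_apply, add_smul, Finset.sum_add_distrib]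
    rw [Subalgebra.coe_add, Subalgebra.coe_add, map_add, map_add, ha m hm, hb m hm]
  | smul r x _ hx =>
    obtain ⟨a, ha⟩ := hx
    refine ⟨r • a, fun m hm => ?_⟩
    simp only [Pi.smul_apply, smul_assoc, ← Finset.smul_sum]
    rw [Subalgebra.coe_smul, Subalgebra.coe_smul, map_smul, map_smul, ha m hm]

/-- The `p_μ`, `μ ⊢ n`, span the symmetric functions of degree `n`. -/
theorem exists_eq_sum_psumPart [Algebra ℚ R] {n : ℕ} (f : SymFunc R)
    (hf : IsHomog n (f : MvPowerSeries ℕ R)) :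
    ∃ a : n.Partition → R, f = ∑ μ, a μ • psumPart R μ := by
  obtain ⟨a, ha⟩ := exists_coeff_eq_sum_psumPart f n
  refine ⟨a, Subtype.ext (MvPowerSeries.ext fun m => ?_)⟩
  by_cases hm : m.degree = n
  · exact ha m hm
  · rw [hf m hm, ← Subalgebra.val_apply, map_sum, map_sum]
    refine (Finset.sum_eq_zero fun μ _ => ?_).symm
    rw [map_smul, map_smul]
    have h := isHomog_multiset_prod_psum (R := R) μ.parts m (by rw [μ.parts_sum]; exact hm)
    exact (congrArg (a μ • ·) h).trans (smul_zero _)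

theorem isHomog_chromaticQSym {V : Type*} [Fintype V] (D : Digraph V) :
    IsHomog (Fintype.card V) (chromaticQSym D) := by
  classical
  intro m hm
  refine Finset.sum_eq_zero fun κ hκ => absurd ?_ hm
  rw [← (Finset.mem_filter.1 hκ).2.2, colorExponent, map_sum]
  simp

end Span

/-! ### Comparison of coefficients. -/

section Main

variable {n : ℕ}

theorem zPart_pos (μ : n.Partition) : 0 < zPart μ :=
  Finset.prod_pos fun _ hi => Nat.mul_pos (Nat.factorial_pos _)
    (pow_pos (μ.parts_pos (Multiset.mem_toFinset.1 hi)) _)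

/-- Applying the functional for `μ` to the power sum expansion of `X` isolates `z_μ` times the
coefficient of `p_μ`. The sign found on the other side is the one by which `ω` scales `p_μ`. -/
theorem omegaInvolution_chromaticQSym (D : Digraph (Fin n))
    (hX : chromaticQSym D ∈ SymFunc (Polynomial ℚ)) :
    omegaInvolution (Polynomial ℚ) ⟨chromaticQSym D, hX⟩ =
      ∑ μ : n.Partition, (Polynomial.C ((zPart μ : ℚ)⁻¹) *
        ∑ σ ∈ NSet μ D.toSimpleGraphInclusive, Polynomial.X ^ digraphInv D σ) •
          psumPart (Polynomial ℚ) μ := by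
  have hhom := isHomog_chromaticQSym D
  rw [Fintype.card_fin] at hhom
  obtain ⟨a, ha⟩ := exists_eq_sum_psumPart ⟨chromaticQSym D, hX⟩ hhom
  have hcoef : ∀ μ : n.Partition, a μ * (zPart μ : Polynomial ℚ) =
      (-1) ^ (∑ i, ((sortedComposition μ).blocksFun i + 1)) *
        ∑ σ ∈ NSet μ D.toSimpleGraphInclusive, Polynomial.X ^ digraphInv D σ := by
    intro μ
    -- With `n` columns every strict labeling of the `n` vertices fits into a row, and so does every
    -- labeling of the at most `n` parts of a partition of `n`.
    have h1 := rowFunctional_chromaticQSym D (N := n) (by simp) (sortedComposition μ).blocksFun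
    rw [← sum_NSet, Fintype.card_fin] at h1
    rw [← h1]
    have h2 : chromaticQSym D = ∑ ρ, a ρ • (psumPart (Polynomial ℚ) ρ : MvPowerSeries ℕ _) := by
      have := congrArg (SymFunc (Polynomial ℚ)).val ha
      simpa using this
    rw [h2, map_sum]
    simp only [map_smul, rowFunctional_psumPart, smul_eq_mul, mul_ite, mul_zero]
    rw [Finset.sum_ite_eq' Finset.univ μ, if_pos (Finset.mem_univ _)]
  rw [ha, map_sum]
  refine Finset.sum_congr rfl fun μ _ => ?_
  rw [map_smul, omegaInvolution_psumPart, Algebra.smul_def, Algebra.smul_def, ← mul_assoc]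
  congr 1
  have hz : Polynomial.C ((zPart μ : ℚ)⁻¹) * (zPart μ : Polynomial ℚ) = 1 := by
    rw [← map_natCast Polynomial.C, ← map_mul, inv_mul_cancel₀, map_one]
    exact_mod_cast (zPart_pos μ).ne'
  have hs := neg_one_pow_mul_self (A := Polynomial ℚ)
    (∑ i, ((sortedComposition μ).blocksFun i + 1))
  have h3 : a μ * (-1) ^ (∑ i, ((sortedComposition μ).blocksFun i + 1)) =
      Polynomial.C ((zPart μ : ℚ)⁻¹) *
        ∑ σ ∈ NSet μ D.toSimpleGraphInclusive, Polynomial.X ^ digraphInv D σ := by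
    linear_combination (Polynomial.C ((zPart μ : ℚ)⁻¹) *
      (-1) ^ (∑ i, ((sortedComposition μ).blocksFun i + 1))) * hcoef μ -
      (a μ * (-1) ^ (∑ i, ((sortedComposition μ).blocksFun i + 1))) * hz +
      (Polynomial.C ((zPart μ : ℚ)⁻¹) *
        ∑ σ ∈ NSet μ D.toSimpleGraphInclusive, Polynomial.X ^ digraphInv D σ) * hs
  rw [← h3, map_mul, map_pow, map_neg, map_one]

end Main

end ChromQSym

end

theorem theorem4p2 {n : ℕ} (D : Digraph (Fin n)) (hD : ∀ v, ¬ D.Adj v v)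
    (hX : ChromQSym.chromaticQSym D ∈ ChromQSym.SymFunc (Polynomial ℚ)) :
    ChromQSym.IsPPositive n
        (ChromQSym.omegaInvolution (Polynomial ℚ) ⟨ChromQSym.chromaticQSym D, hX⟩) ∧
      ChromQSym.omegaInvolution (Polynomial ℚ) ⟨ChromQSym.chromaticQSym D, hX⟩ =
        ∑ μ : n.Partition,
          (Polynomial.C ((ChromQSym.zPart μ : ℚ)⁻¹) *
            ∑ σ ∈ ChromQSym.NSet μ D.toSimpleGraphInclusive,
              Polynomial.X ^ ChromQSym.digraphInv D σ) •
            ChromQSym.psumPart (Polynomial ℚ) μ := by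
  have hmain := ChromQSym.omegaInvolution_chromaticQSym D hX
  refine ⟨⟨_, fun μ j => ?_, hmain⟩, hmain⟩
  rw [Polynomial.coeff_C_mul, Polynomial.finsetSum_coeff]
  refine mul_nonneg (by positivity) (Finset.sum_nonneg fun σ _ => ?_)
  rw [Polynomial.coeff_X_pow]
  split_ifs <;> simp
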